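/- **Setting.** For $f_0:\mathbb R^d\to\mathbb R$, $\bar g:\mathbb R^{\bar n}\to\mathbb R\cup\{+\infty\}$, $A\in\mathbb R^{n\times d}$, $b\in\mathbb R^n$, $\bar A\in\mathbb R^{\bar n\times d}$, $\bar b\in\mathbb R^{\bar n}$ consider $$(P)\quad \min_x F_0(x):=f_0(x)+g(x),\ \ g(x):=\bar g(\bar Ax+\bar b),\quad\text{s.t. } Ax+b=0,$$ $$(SP)\quad \min_{x,y} f_0(x)+\bar g(y)\quad\text{s.t. } Ax+b=0,\ y=\bar Ax+\bar b .$$ *Problem class (with parameter $L_f$).* $\inf_x F_0(x)>-\infty$; $f_0$ is differentiable with $L_f$-Lipschitz gradient; $\bar g$ is proper, lower semicontinuous and convex, $\mathrm{relint}(\mathrm{dom}\,\bar g)\ne\emptyset$, and $\mathrm{dom}\,\bar g$ is not a singleton. *$\epsilon$-stationarity.* $(x,y)$ is an $\epsilon$-stationary point of (SP) if for some $z_1\in\mathbb R^{\bar n}$, $z_2\in\mathbb R^n$ each of $\mathrm{dist}(0,\partial\bar g(y)-z_1)$, $\|\nabla f_0(x)+\bar A^\top z_1+A^\top z_2\|$,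 $\|y-\bar Ax-\bar b\|$, $\|Ax+b\|$ is at most $\epsilon$. *Algorithm class.* First-order methods started at $(x^{(0)},y^{(0)})=(0,0)$ whose iterates satisfy, for all $t\ge1$, $$x^{(t)}\in\mathrm{span}\{x^{(s)},\nabla f_0(x^{(s)}),A^\top b,A^\top Ax^{(s)},\bar A^\top\bar b,\bar A^\top\bar Ax^{(s)},\bar A^\top y^{(s)}\}_{s=0}^{t-1},$$ $$y^{(t)}\in\mathrm{span}\{\xi^{(t)},\mathrm{prox}_{\eta_t\bar g}(\xi^{(t)})\},\quad \eta_t>0,\quad \xi^{(t)}\in\mathrm{span}\{\bar b,y^{(s)},\bar A\bar A^\top y^{(s)},\bar Ax^{(s)}\}_{s=0}^{t-1},$$ where $\mathrm{prox}_{\eta\bar g}(v)=\arg\min_w\{\bar g(w)+\tfrac1{2\eta}\|w-v\|^2\}$. Each update uses one call to the oracle that returns $(\nabla f_0(x),\bar Ax,Ax,\bar A^\top y,A^\top z,\mathrm{prox}_{\eta\bar g}(y))$ at a query $(x,y,z,\eta)$, so $(x^{(t)},y^{(t)})$ is obtained after $t$ oracle calls. *Instance $\mathcal P$.* Let $\epsilon,L_f>0$,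 let $m_1\ge2$ and $m_2\ge1$ be integers with $m_1m_2$ even, $\bar d\ge5$ odd, $m=3m_1m_2$, $d=m\bar d$, and write $x=(x_1,\dots,x_m)$ with $x_i\in\mathbb R^{\bar d}$. Let $J_m\in\mathbb R^{(m-1)\times m}$ be the matrix whose $i$-th row has $-1$ in column $i$, $1$ in column $i+1$ and $0$ elsewhere, let $\mathcal M=\{im_1:1\le i\le 3m_2-1\}$, and let $J_{\mathcal M}$, $J_{\mathcal M^C}$ consist of the rows of $J_m$ with indices in, respectively not in, $\mathcal M$. Put $\bar A=mL_fJ_{\mathcal M}\otimes I_{\bar d}$, $A=mL_fJ_{\mathcal M^C}\otimes I_{\bar d}$, $b=0$, $\bar b=0$, $\bar g(y)=\frac{\beta}{mL_f}\|y\|_1$ with any $\beta>(50\pi+1+\|A\|)\sqrt m\,\epsilon$ ($\|A\|$ the spectral norm), and $f_0(x)=\sum_{i=1}^m f_i(x_i)$ with $$f_i(z)=\tfrac{300\pi\epsilon^2}{mL_f}\,h_i\Big(\tfrac{\sqrt m L_f z}{150\pi\epsilon}\Big),$$ where $h_i(z)=\varphi(z,1)+3\sum_{j=1}^{\lfloor\bar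 d/2\rfloor}\varphi(z,2j)$ for $i\le\frac m3$, $h_i(z)=\varphi(z,1)$ for $\frac m3<i\le\frac{2m}3$, and $h_i(z)=\varphi(z,1)+3\sum_{j=1}^{\lfloor\bar d/2\rfloor}\varphi(z,2j+1)$ for $i>\frac{2m}3$; here $\varphi(z,1)=-\Psi(1)\Phi([z]_1)$, $\varphi(z,j)=\Psi(-[z]_{j-1})\Phi(-[z]_j)-\Psi([z]_{j-1})\Phi([z]_j)$ for $j\ge2$, $\Psi(u)=0$ for $u\le0$, $\Psi(u)=1-e^{-u^2}$ for $u>0$, and $\Phi(v)=4\arctan v+2\pi$. **Theorem 2.** Let $\epsilon>0$ and $L_f>0$. For every choice of $m_1,m_2,\bar d,\beta$ as above, instance $\mathcal P$ belongs to the problem class with parameter $L_f$, and every first-order method in the algorithm class, started at $(x^{(0)},y^{(0)})=(0,0)$, needs at least $$\left\lceil\frac{\kappa([\bar A;A])\,L_f\,\Delta_{F_0}}{72000\pi^2}\,\epsilon^{-2}\right\rceil$$ oracle calls to obtain an $\epsilon$-stationary point of the reformulation (SP) of $\mathcal P$. Here $\Delta_{F_0}=F_0(x^{(0)})-\inf_xF_0(x)$,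 $[\bar A;A]$ is $\bar A$ stacked on $A$, and $\kappa(M)=\sqrt{\lambda_{\max}(MM^\top)/\lambda^+_{\min}(MM^\top)}$ with $\lambda^+_{\min}$ the smallest positive eigenvalue. -/

import Mathlib

open scoped Kronecker Matrix

noncomputable section

namespace AffineComposite

/-! ### Composite problems with affine constraints -/

/-- Data of the problem `min f₀(x) + ḡ(Ā x + b̄)` subject to `A x + b = 0`, with `x ∈ ℝ^ι`,
`A ∈ ℝ^(ν × ι)` and `Ā ∈ ℝ^(ν' × ι)`. The function `ḡ` may take the value `+∞`. -/
structure Problem (ι ν ν' : Type*) where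
  f₀ : EuclideanSpace ℝ ι → ℝ
  gbar : EuclideanSpace ℝ ν' → EReal
  A : Matrix ν ι ℝ
  b : EuclideanSpace ℝ ν
  Abar : Matrix ν' ι ℝ
  bbar : EuclideanSpace ℝ ν'

/-- The effective domain of an extended-real-valued function. -/
def effDom {E : Type*} (g : E → EReal) : Set E := {y | g y ≠ ⊤}

/-- Proper: never `-∞` and not identically `+∞`. -/
def IsProper {E : Type*} (g : E → EReal) : Prop := (∀ y, g y ≠ ⊥) ∧ (effDom g).Nonempty

/-- Convexity of an extended-real-valued function, through its epigraph. -/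
def IsConvexFun {E : Type*} [AddCommGroup E] [Module ℝ E] (g : E → EReal) : Prop :=
  Convex ℝ {p : E × ℝ | g p.1 ≤ (p.2 : EReal)}

/-- The convex subdifferential. For a proper `g` it is empty outside the effective domain. -/
def subdifferential {E : Type*} [NormedAddCommGroup E] [InnerProductSpace ℝ E]
    (g : E → EReal) (y : E) : Set E :=
  {ξ | ∀ w, g y + ((inner ℝ ξ (w - y) : ℝ) : EReal) ≤ g w}

/-- `p` is a minimizer of `g(w) + ‖w - v‖² / (2 η)`, that is, `p = prox_{η g}(v)`. -/
def IsProx {E : Type*} [NormedAddCommGroup E] (g : E → EReal) (η : ℝ) (v p : E) : Prop :=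
  ∀ w, g p + ((‖p - v‖ ^ 2 / (2 * η) : ℝ) : EReal) ≤ g w + ((‖w - v‖ ^ 2 / (2 * η) : ℝ) : EReal)

/-- `L`-smoothness: differentiable with `L`-Lipschitz gradient. -/
def IsSmoothWith {E : Type*} [NormedAddCommGroup E] [InnerProductSpace ℝ E] [CompleteSpace E]
    (L : ℝ) (f : E → ℝ) : Prop :=
  Differentiable ℝ f ∧ ∀ x x', ‖gradient f x - gradient f x'‖ ≤ L * ‖x - x'‖

namespace Problem

variable {ι ν ν' : Type*} [Fintype ι] [DecidableEq ι] [Fintype ν] [DecidableEq ν]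
  [Fintype ν'] [DecidableEq ν']

/-- The nonsmooth term `g(x) = ḡ(Ā x + b̄)`. -/
def g (P : Problem ι ν ν') (x : EuclideanSpace ℝ ι) : EReal :=
  P.gbar (P.Abar.toEuclideanLin x + P.bbar)

/-- The objective `F₀ = f₀ + g`. -/
def F₀ (P : Problem ι ν ν') (x : EuclideanSpace ℝ ι) : EReal := (P.f₀ x : EReal) + P.g x

/-- The problem class: `F₀` is bounded below, `f₀` is `L`-smooth, and `ḡ` is proper, lower
semicontinuous and convex, with a domain that has nonempty relative interior and is not a
singleton. -/
structure InClass (P : Problem ι ν ν') (L : ℝ) : Prop where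
  bddBelow : ⊥ < ⨅ x, P.F₀ x
  smooth : IsSmoothWith L P.f₀
  proper : IsProper P.gbar
  lsc : LowerSemicontinuous P.gbar
  convex : IsConvexFun P.gbar
  relint : (intrinsicInterior ℝ (effDom P.gbar)).Nonempty
  not_singleton : ¬ ∃ y, effDom P.gbar = {y}

/-- The initial gap `F₀(x⁰) - inf F₀` (a real number whenever `F₀(x⁰) < ∞` and `inf F₀ > -∞`). -/
def gap (P : Problem ι ν ν') (x₀ : EuclideanSpace ℝ ι) : ℝ :=
  (P.F₀ x₀ - ⨅ x, P.F₀ x).toReal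

/-- `(x, y)` is an `ε`-stationary point of the splitting reformulation
`min f₀(x) + ḡ(y)` subject to `A x + b = 0`, `y = Ā x + b̄`.
The distance to the empty set is `∞`. -/
def IsStationarySP (P : Problem ι ν ν') (ε : ℝ)
    (x : EuclideanSpace ℝ ι) (y : EuclideanSpace ℝ ν') : Prop :=
  ∃ (z₁ : EuclideanSpace ℝ ν') (z₂ : EuclideanSpace ℝ ν),
    Metric.infEDist 0 ((fun ξ => ξ - z₁) '' subdifferential P.gbar y) ≤ ENNReal.ofReal ε ∧
    ‖gradient P.f₀ x + P.Abarᵀ.toEuclideanLin z₁ + P.Aᵀ.toEuclideanLin z₂‖ ≤ ε ∧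
    ‖y - P.Abar.toEuclideanLin x - P.bbar‖ ≤ ε ∧
    ‖P.A.toEuclideanLin x + P.b‖ ≤ ε

/-- The vectors available for forming the `x`-iterate number `t`. -/
def xInfo (P : Problem ι ν ν') (x : ℕ → EuclideanSpace ℝ ι) (y : ℕ → EuclideanSpace ℝ ν')
    (t : ℕ) : Set (EuclideanSpace ℝ ι) :=
  ⋃ s ∈ Set.Iio t,
    {x s, gradient P.f₀ (x s),
      P.Aᵀ.toEuclideanLin P.b, P.Aᵀ.toEuclideanLin (P.A.toEuclideanLin (x s)),
      P.Abarᵀ.toEuclideanLin P.bbar, P.Abarᵀ.toEuclideanLin (P.Abar.toEuclideanLin (x s)),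
      P.Abarᵀ.toEuclideanLin (y s)}

/-- The vectors available for forming the point `ξ` whose prox enters the `y`-iterate number `t`. -/
def yInfo (P : Problem ι ν ν') (x : ℕ → EuclideanSpace ℝ ι) (y : ℕ → EuclideanSpace ℝ ν')
    (t : ℕ) : Set (EuclideanSpace ℝ ν') :=
  ⋃ s ∈ Set.Iio t,
    {P.bbar, y s, P.Abar.toEuclideanLin (P.Abarᵀ.toEuclideanLin (y s)),
      P.Abar.toEuclideanLin (x s)}

/-- `(x, y)` is a sequence of iterates, with initial point `(x 0, y 0)`, of a first-order method
with access to `∇f₀`, to `prox_{η ḡ}` and to products with `A`, `Ā` and their transposes. -/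
structure IsFOMRun (P : Problem ι ν ν') (x : ℕ → EuclideanSpace ℝ ι)
    (y : ℕ → EuclideanSpace ℝ ν') : Prop where
  x_mem : ∀ t, 1 ≤ t → x t ∈ Submodule.span ℝ (P.xInfo x y t)
  y_mem : ∀ t, 1 ≤ t → ∃ η : ℝ, 0 < η ∧ ∃ ξ ∈ Submodule.span ℝ (P.yInfo x y t),
    ∃ p, IsProx P.gbar η ξ p ∧ y t ∈ Submodule.span ℝ {ξ, p}

/-- The number of oracle calls, one for each update `(x t, y t) ↦ (x (t+1), y (t+1))`, after which
the run has produced its first `ε`-stationary point of the splitting reformulation;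
`⊤` if it never does. -/
def oracleCalls (P : Problem ι ν ν') (ε : ℝ) (x : ℕ → EuclideanSpace ℝ ι)
    (y : ℕ → EuclideanSpace ℝ ν') : ℕ∞ :=
  ⨅ (t : ℕ) (_ : P.IsStationarySP ε (x t) (y t)), (t : ℕ∞)

end Problem

/-! ### Matrix quantities -/

/-- The condition number `√(λ_max(M Mᵀ) / λ⁺_min(M Mᵀ))`, where `λ⁺_min` is the smallest positive
eigenvalue. -/
def condNumber {ρ ι : Type*} [Fintype ρ] [DecidableEq ρ] [Fintype ι] (M : Matrix ρ ι ℝ) : ℝ :=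
  √(sSup {μ : ℝ | Module.End.HasEigenvalue (Matrix.toLin' (M * Mᵀ)) μ} /
    sInf {μ : ℝ | Module.End.HasEigenvalue (Matrix.toLin' (M * Mᵀ)) μ ∧ 0 < μ})

/-- The spectral norm. -/
def specNorm {ρ ι : Type*} [Fintype ρ] [Fintype ι] [DecidableEq ι] (M : Matrix ρ ι ℝ) : ℝ :=
  ‖LinearMap.toContinuousLinearMap (Matrix.toEuclideanLin M)‖

/-- The `(p-1) × p` matrix with rows `(0, …, 0, -1, 1, 0, …, 0)`. -/
def J (p : ℕ) : Matrix (Fin (p - 1)) (Fin p) ℝ :=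
  Matrix.of fun i j => if j.val = i.val then -1 else if j.val = i.val + 1 then 1 else 0

/-! ### The hard instance -/

/-- The number `m = 3 m₁ m₂` of blocks. -/
abbrev numBlocks (m₁ m₂ : ℕ) : ℕ := 3 * m₁ * m₂

/-- The row set `{i m₁ : 1 ≤ i ≤ 3 m₂ - 1}`; the row with index `r : Fin (m - 1)` has number
`r + 1`. -/
def rowsM (m₁ m₂ : ℕ) : Finset (Fin (numBlocks m₁ m₂ - 1)) :=
  Finset.univ.filter fun r => r.val + 1 ∈ (Finset.Icc 1 (3 * m₂ - 1)).image (fun i => i * m₁)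

/-- Index type of `ℝ^d`, `d = m d̄`: (block, coordinate in the block). -/
abbrev VarIdx (m₁ m₂ dbar : ℕ) : Type := Fin (numBlocks m₁ m₂) × Fin dbar

/-- Index type of the rows of `Ā`. -/
abbrev RegIdx (m₁ m₂ dbar : ℕ) : Type := {r // r ∈ rowsM m₁ m₂} × Fin dbar

/-- Index type of the rows of `A`. -/
abbrev ConIdx (m₁ m₂ dbar : ℕ) : Type := {r // r ∉ rowsM m₁ m₂} × Fin dbar

/-- `Ā = m L J_M ⊗ I`. -/
def hardAbar (m₁ m₂ dbar : ℕ) (L : ℝ) : Matrix (RegIdx m₁ m₂ dbar) (VarIdx m₁ m₂ dbar) ℝ :=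
  ((numBlocks m₁ m₂ : ℝ) * L) •
    ((J (numBlocks m₁ m₂)).submatrix Subtype.val id ⊗ₖ (1 : Matrix (Fin dbar) (Fin dbar) ℝ))

/-- `A = m L J_{Mᶜ} ⊗ I`. -/
def hardA (m₁ m₂ dbar : ℕ) (L : ℝ) : Matrix (ConIdx m₁ m₂ dbar) (VarIdx m₁ m₂ dbar) ℝ :=
  ((numBlocks m₁ m₂ : ℝ) * L) •
    ((J (numBlocks m₁ m₂)).submatrix Subtype.val id ⊗ₖ (1 : Matrix (Fin dbar) (Fin dbar) ℝ))

def Psi (u : ℝ) : ℝ := if u ≤ 0 then 0 else 1 - Real.exp (-u ^ 2)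

def Phi (v : ℝ) : ℝ := 4 * Real.arctan v + 2 * Real.pi

/-- The coordinate `[z]_k` with the numbering `k = 1, …, d̄` (only such `k` are used). -/
def coord {dbar : ℕ} (z : EuclideanSpace ℝ (Fin dbar)) (k : ℕ) : ℝ :=
  if h : k - 1 < dbar then z ⟨k - 1, h⟩ else 0

/-- `φ(z, j)` for `1 ≤ j ≤ d̄`. -/
def phi {dbar : ℕ} (z : EuclideanSpace ℝ (Fin dbar)) (j : ℕ) : ℝ :=
  if j = 1 then -Psi 1 * Phi (coord z 1)
  else Psi (-coord z (j - 1)) * Phi (-coord z j) - Psi (coord z (j - 1)) * Phi (coord z j)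

/-- `h_i` for `1 ≤ i ≤ m`, where `m / 3 = m₁ m₂`. -/
def h (m₁ m₂ : ℕ) {dbar : ℕ} (i : ℕ) (z : EuclideanSpace ℝ (Fin dbar)) : ℝ :=
  if i ≤ m₁ * m₂ then phi z 1 + 3 * ∑ j ∈ Finset.Icc 1 (dbar / 2), phi z (2 * j)
  else if i ≤ 2 * (m₁ * m₂) then phi z 1
  else phi z 1 + 3 * ∑ j ∈ Finset.Icc 1 (dbar / 2), phi z (2 * j + 1)

/-- `f_i(z) = (300 π ε² / (m L)) h_i(√m L z / (150 π ε))` for `1 ≤ i ≤ m`. -/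
def f (m₁ m₂ : ℕ) {dbar : ℕ} (ε L : ℝ) (i : ℕ) (z : EuclideanSpace ℝ (Fin dbar)) : ℝ :=
  300 * Real.pi * ε ^ 2 / ((numBlocks m₁ m₂ : ℝ) * L) *
    h m₁ m₂ i ((√(numBlocks m₁ m₂ : ℝ) * L / (150 * Real.pi * ε)) • z)

/-- The block of `x` with index `i`. -/
def block {m dbar : ℕ} (x : EuclideanSpace ℝ (Fin m × Fin dbar)) (i : Fin m) :
    EuclideanSpace ℝ (Fin dbar) :=
  WithLp.toLp 2 fun j => x (i, j)

/-- The hard instance: `f₀(x) = ∑ᵢ f_i(x_i)`, `ḡ(y) = (β / (m L)) ‖y‖₁`, `b = 0`, `b̄ = 0`. -/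
def hardInstance (m₁ m₂ dbar : ℕ) (ε L β : ℝ) :
    Problem (VarIdx m₁ m₂ dbar) (ConIdx m₁ m₂ dbar) (RegIdx m₁ m₂ dbar) where
  f₀ x := ∑ i : Fin (numBlocks m₁ m₂), f m₁ m₂ ε L (i.val + 1) (block x i)
  gbar y := ((β / ((numBlocks m₁ m₂ : ℝ) * L) * ∑ k, |y k| : ℝ) : EReal)
  A := hardA m₁ m₂ dbar L
  b := 0
  Abar := hardAbar m₁ m₂ dbar L
  bbar := 0

end AffineComposite

end

open scoped Kronecker Matrix

noncomputable section

namespace AffineComposite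

/-! ### The scalar functions `Psi` and `Phi` -/

/-! The instance splits a nonconvex zero-chain between the outer thirds of the blocks. With
coordinates numbered from 0, coordinate `k ≥ 1` can be activated by coordinate `k - 1` through the
gradient only in the first third of the blocks if `k` is odd, and only in the last third if `k` is
even. `A` and `Ā` connect adjacent blocks only, and the prox of the `ℓ¹`-norm keeps zeros. Each
further coordinate therefore waits until its predecessor has crossed the middle third, which has `N
= m₁ m₂` blocks, and the last coordinate of every block is zero at all iterations `t < (d̄ - 2) N`
(`iterates_support`).

A point whose last coordinates vanish is not stationary (`not_isStationarySP`). Summing the gradient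
condition over an initial run of blocks telescopes to a single multiplier, which is too small to be
near a subgradient of `ḡ` at a nonzero entry because `β` is large; hence `y = 0`
(`stationary_split_eq_zero`). The two feasibility residuals then make the blocks almost equal
(`sum_norm_block_sub_le`). Summing over all blocks removes the multipliers, and the weights average
to one, so the summed gradient is close to a multiple of the gradient of the unsplit chain. That
gradient has an entry below `-1` (`exists_chainPartial_one_lt`), which is too large.

For the count, `condNumber_le` gives `κ ≤ 2m` and `gap_le` gives `Δ ≤ 1200 π² ε² d̄ / L`, so the
claimed number is at most `d̄ N / 10 ≤ (d̄ - 2) N`. -/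

def dPsi (u : ℝ) : ℝ := if u ≤ 0 then 0 else 2 * u * Real.exp (-u ^ 2)

def dPhi (v : ℝ) : ℝ := 4 / (1 + v ^ 2)

lemma Psi_of_nonpos {u : ℝ} (hu : u ≤ 0) : Psi u = 0 := if_pos hu

lemma dPsi_of_nonpos {u : ℝ} (hu : u ≤ 0) : dPsi u = 0 := if_pos hu

/-- The truncation becomes composition with the nonexpansive monotone map `max · 0`, so monotonicity
of `Psi` and the Lipschitz bound for `dPsi` follow from the smooth branch. -/
lemma Psi_eq_max (u : ℝ) : Psi u = 1 - Real.exp (-(max u 0) ^ 2) := by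
  unfold Psi
  split_ifs with hu
  · simp [max_eq_right hu]
  · rw [max_eq_left (not_le.1 hu).le]

lemma dPsi_eq_max (u : ℝ) : dPsi u = 2 * max u 0 * Real.exp (-(max u 0) ^ 2) := by
  unfold dPsi
  split_ifs with hu
  · simp [max_eq_right hu]
  · rw [max_eq_left (not_le.1 hu).le]

lemma hasDerivAt_one_sub_exp (u : ℝ) :
    HasDerivAt (fun u : ℝ => 1 - Real.exp (-u ^ 2)) (2 * u * Real.exp (-u ^ 2)) u := by
  have h1 : HasDerivAt (fun u : ℝ => -u ^ 2) (-(2 * u)) u := by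
    exact (hasDerivAt_pow 2 u).fun_neg.congr_deriv (by simp)
  exact ((h1.exp).const_sub 1).congr_deriv (by ring)

lemma hasDerivAt_mul_exp (u : ℝ) :
    HasDerivAt (fun u : ℝ => 2 * u * Real.exp (-u ^ 2))
      ((2 - 4 * u ^ 2) * Real.exp (-u ^ 2)) u := by
  have h1 : HasDerivAt (fun u : ℝ => -u ^ 2) (-(2 * u)) u := by
    exact (hasDerivAt_pow 2 u).fun_neg.congr_deriv (by simp)
  exact (((hasDerivAt_id u).const_mul 2).fun_mul h1.exp).congr_deriv (by simp only [id]; ring)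

/-- At the kink both one-sided derivatives are zero, so the branches glue. -/
lemma hasDerivAt_Psi (u : ℝ) : HasDerivAt Psi (dPsi u) u := by
  have hl : ∀ u ≤ (0 : ℝ), HasDerivWithinAt Psi (dPsi u) (Set.Iic 0) u := by
    intro u hu
    rw [dPsi_of_nonpos hu]
    exact (hasDerivWithinAt_const u (Set.Iic (0 : ℝ)) (0 : ℝ)).congr
      (fun v hv => Psi_of_nonpos hv) (Psi_of_nonpos hu)
  have hr : ∀ u, (0 : ℝ) ≤ u → HasDerivWithinAt Psi (dPsi u) (Set.Ici 0) u := by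
    intro u hu
    have h1 := (hasDerivAt_one_sub_exp u).hasDerivWithinAt (s := Set.Ici 0)
    rw [dPsi_eq_max, max_eq_left hu]
    exact h1.congr (fun v hv => by rw [Psi_eq_max, max_eq_left hv])
      (by rw [Psi_eq_max, max_eq_left hu])
  rcases lt_trichotomy u 0 with hu | hu | hu
  · exact (hl u hu.le).hasDerivAt (Iic_mem_nhds hu)
  · subst hu
    have := (hl 0 le_rfl).union (hr 0 le_rfl)
    rwa [Set.Iic_union_Ici, hasDerivWithinAt_univ] at this
  · exact (hr u hu.le).hasDerivAt (Ici_mem_nhds hu)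

lemma hasDerivAt_Phi (v : ℝ) : HasDerivAt Phi (dPhi v) v := by
  exact (((Real.hasDerivAt_arctan v).const_mul 4).add_const (2 * Real.pi)).congr_deriv
    (by unfold dPhi; ring)

lemma Psi_nonneg (u : ℝ) : 0 ≤ Psi u := by
  rw [Psi_eq_max, sub_nonneg, Real.exp_le_one_iff]
  nlinarith [sq_nonneg (max u 0)]

lemma Psi_le_one (u : ℝ) : Psi u ≤ 1 := by
  rw [Psi_eq_max]
  linarith [Real.exp_pos (-(max u 0) ^ 2)]

/-- Together with `dPhi > 2` on `(-1, 1)` this makes the decisive partial derivative drop below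
`-1`. -/
lemma Psi_one_gt_half : 1 / 2 < Psi 1 := by
  have h1 : Psi 1 = 1 - Real.exp (-1) := by
    rw [Psi_eq_max]; norm_num
  have h2 : Real.exp (-1) < 1 / 2 := by
    rw [Real.exp_neg, inv_lt_comm₀ (Real.exp_pos _) (by norm_num)]
    linarith [Real.exp_one_gt_d9]
  linarith

lemma Psi_mono : Monotone Psi := by
  intro u v huv
  rw [Psi_eq_max, Psi_eq_max]
  have : max u 0 ≤ max v 0 := max_le_max_right 0 huv
  have h0 : 0 ≤ max u 0 := le_max_right _ _
  have : Real.exp (-(max v 0) ^ 2) ≤ Real.exp (-(max u 0) ^ 2) := by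
    apply Real.exp_le_exp.2
    nlinarith
  linarith

lemma mul_exp_neg_sq_le_one (u : ℝ) : |2 * u * Real.exp (-u ^ 2)| ≤ 1 := by
  rw [Real.exp_neg, ← div_eq_mul_inv, abs_div, abs_of_pos (Real.exp_pos _),
    div_le_one (Real.exp_pos _)]
  have h := Real.add_one_le_exp (u ^ 2)
  refine le_trans ?_ h
  rw [abs_le]
  constructor <;> nlinarith [sq_nonneg (u - 1), sq_nonneg (u + 1)]

lemma dPsi_nonneg (u : ℝ) : 0 ≤ dPsi u := by
  rw [dPsi_eq_max]
  have : 0 ≤ max u 0 := le_max_right _ _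
  positivity

lemma dPsi_le_one (u : ℝ) : dPsi u ≤ 1 := by
  rw [dPsi_eq_max]
  exact (le_abs_self _).trans (mul_exp_neg_sq_le_one _)

lemma abs_sub_le_of_hasDerivAt {F F' : ℝ → ℝ} {C : ℝ} (hF : ∀ u, HasDerivAt F (F' u) u)
    (hC : ∀ u, |F' u| ≤ C) (u v : ℝ) : |F u - F v| ≤ C * |u - v| := by
  have := Convex.norm_image_sub_le_of_norm_hasDerivWithin_le (f := F) (f' := F') (s := Set.univ)
    (x := v) (y := u) (C := C) (fun x _ => (hF x).hasDerivWithinAt) (fun x _ => hC x)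
    convex_univ (Set.mem_univ _) (Set.mem_univ _)
  simpa using this

lemma abs_Psi_sub_le (u v : ℝ) : |Psi u - Psi v| ≤ |u - v| := by
  rw [← one_mul |u - v|]
  refine abs_sub_le_of_hasDerivAt hasDerivAt_Psi (fun u => ?_) u v
  rw [abs_of_nonneg (dPsi_nonneg u)]
  exact dPsi_le_one u

lemma abs_dPsi_sub_le (u v : ℝ) : |dPsi u - dPsi v| ≤ 2 * |u - v| := by
  rw [dPsi_eq_max, dPsi_eq_max]
  have h1 : ∀ u : ℝ, |(2 - 4 * u ^ 2) * Real.exp (-u ^ 2)| ≤ 2 := by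
    intro u
    rw [Real.exp_neg, ← div_eq_mul_inv, abs_div, abs_of_pos (Real.exp_pos _),
      div_le_iff₀ (Real.exp_pos _)]
    have h := Real.quadratic_le_exp_of_nonneg (sq_nonneg u)
    rw [abs_le]
    constructor <;> nlinarith [sq_nonneg (u ^ 2 - 1), sq_nonneg u]
  have h2 := abs_sub_le_of_hasDerivAt hasDerivAt_mul_exp h1 (max u 0) (max v 0)
  have h3 := abs_max_sub_max_le_abs u v 0
  linarith

lemma Phi_pos (v : ℝ) : 0 < Phi v := by
  unfold Phi
  linarith [Real.neg_pi_div_two_lt_arctan v]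

lemma Phi_lt (v : ℝ) : Phi v < 4 * Real.pi := by
  unfold Phi
  linarith [Real.arctan_lt_pi_div_two v]

lemma dPhi_pos (v : ℝ) : 0 < dPhi v := by
  unfold dPhi
  positivity

lemma dPhi_le (v : ℝ) : dPhi v ≤ 4 := by
  unfold dPhi
  rw [div_le_iff₀ (by positivity)]
  nlinarith [sq_nonneg v]

lemma dPhi_neg (v : ℝ) : dPhi (-v) = dPhi v := by
  simp [dPhi]

lemma two_lt_dPhi {v : ℝ} (hv : |v| < 1) : 2 < dPhi v := by
  unfold dPhi
  rw [lt_div_iff₀ (by positivity)]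
  have := (sq_lt_one_iff_abs_lt_one v).2 hv
  linarith

lemma abs_Phi_sub_le (u v : ℝ) : |Phi u - Phi v| ≤ 4 * |u - v| := by
  refine abs_sub_le_of_hasDerivAt hasDerivAt_Phi (fun u => ?_) u v
  rw [abs_of_pos (dPhi_pos u)]
  exact dPhi_le u

lemma abs_dPhi_sub_le (u v : ℝ) : |dPhi u - dPhi v| ≤ 4 * |u - v| := by
  unfold dPhi
  have hu : (0 : ℝ) < 1 + u ^ 2 := by positivity
  have hv : (0 : ℝ) < 1 + v ^ 2 := by positivity
  have h1 : 4 / (1 + u ^ 2) - 4 / (1 + v ^ 2)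
      = 4 * (u - v) * (-(u + v)) / ((1 + u ^ 2) * (1 + v ^ 2)) := by
    field_simp
    ring
  rw [h1, abs_div, abs_mul, abs_mul, abs_of_pos (mul_pos hu hv), div_le_iff₀ (mul_pos hu hv),
    abs_neg, abs_of_pos (by norm_num : (0 : ℝ) < 4)]
  have h2 : |u + v| ≤ (1 + u ^ 2) * (1 + v ^ 2) := by
    rw [abs_le]
    constructor <;>
      nlinarith [sq_nonneg (u - 1), sq_nonneg (v - 1), sq_nonneg (u + 1), sq_nonneg (v + 1),
        mul_nonneg (sq_nonneg u) (sq_nonneg v)]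
  exact mul_le_mul_of_nonneg_left h2 (by positivity)

/-! ### The coupling of two consecutive coordinates -/

def pair (a b : ℝ) : ℝ := Psi (-a) * Phi (-b) - Psi a * Phi b

/-- The partial derivative of `pair` in its first argument. -/
def pairFst (a b : ℝ) : ℝ := -(dPsi (-a) * Phi (-b)) - dPsi a * Phi b

/-- The partial derivative of `pair` in its second argument. -/
def pairSnd (a b : ℝ) : ℝ := -((Psi (-a) + Psi a) * dPhi b)

lemma pair_ge (a b : ℝ) : -(4 * Real.pi) ≤ pair a b := by
  unfold pair
  have h1 := mul_nonneg (Psi_nonneg (-a)) (Phi_pos (-b)).le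
  have h2 := mul_le_mul (Psi_le_one a) (Phi_lt b).le (Phi_pos b).le zero_le_one
  linarith

/-- The zero-chain mechanism: with a zero first argument neither partial derivative sees the second
one. A zero coordinate is not moved by its successor (`pairFst_zero`) and does not move it
(`pairSnd_zero`). -/
lemma pair_zero (b : ℝ) : pair 0 b = 0 := by simp [pair, Psi_of_nonpos]

lemma pairFst_zero (b : ℝ) : pairFst 0 b = 0 := by simp [pairFst, dPsi_of_nonpos]

lemma pairSnd_zero (b : ℝ) : pairSnd 0 b = 0 := by simp [pairSnd, Psi_of_nonpos]

lemma pairFst_nonpos (a b : ℝ) : pairFst a b ≤ 0 := by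
  unfold pairFst
  have h1 := mul_nonneg (dPsi_nonneg (-a)) (Phi_pos (-b)).le
  have h2 := mul_nonneg (dPsi_nonneg a) (Phi_pos b).le
  linarith

/-- At most one of `dPsi a`, `dPsi (-a)` is nonzero, hence `4π` and not `8π`. -/
lemma pairFst_ge (a b : ℝ) : -(4 * Real.pi) ≤ pairFst a b := by
  unfold pairFst
  have h1 := mul_le_mul (dPsi_le_one (-a)) (Phi_lt (-b)).le (Phi_pos (-b)).le zero_le_one
  have h2 := mul_le_mul (dPsi_le_one a) (Phi_lt b).le (Phi_pos b).le zero_le_one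
  rcases le_total a 0 with ha | ha
  · rw [dPsi_of_nonpos ha]; linarith
  · rw [dPsi_of_nonpos (neg_nonpos.2 ha)]; linarith

lemma Psi_neg_add_Psi_le_one (a : ℝ) : Psi (-a) + Psi a ≤ 1 := by
  rcases le_total a 0 with ha | ha
  · rw [Psi_of_nonpos ha]; linarith [Psi_le_one (-a)]
  · rw [Psi_of_nonpos (neg_nonpos.2 ha)]; linarith [Psi_le_one a]

lemma Psi_neg_add_Psi_nonneg (a : ℝ) : 0 ≤ Psi (-a) + Psi a :=
  add_nonneg (Psi_nonneg _) (Psi_nonneg _)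

lemma Psi_one_le_Psi_neg_add_Psi {a : ℝ} (ha : 1 ≤ |a|) : Psi 1 ≤ Psi (-a) + Psi a := by
  rcases le_abs.1 ha with h | h
  · linarith [Psi_mono h, Psi_nonneg (-a)]
  · linarith [Psi_mono h, Psi_nonneg a]

lemma pairSnd_nonpos (a b : ℝ) : pairSnd a b ≤ 0 := by
  unfold pairSnd
  linarith [mul_nonneg (Psi_neg_add_Psi_nonneg a) (dPhi_pos b).le]

lemma pairSnd_ge (a b : ℝ) : -4 ≤ pairSnd a b := by
  unfold pairSnd
  linarith [mul_le_mul (Psi_neg_add_Psi_le_one a) (dPhi_le b) (dPhi_pos b).le zero_le_one]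

lemma pairSnd_lt_neg_one {a b : ℝ} (ha : 1 ≤ |a|) (hb : |b| < 1) : pairSnd a b < -1 := by
  unfold pairSnd
  nlinarith [Psi_one_le_Psi_neg_add_Psi ha, Psi_one_gt_half, two_lt_dPhi hb]

lemma abs_mul_sub_mul_le {p q p' q' P Q : ℝ} (hp : |p'| ≤ P) (hq : |q| ≤ Q) :
    |p * q - p' * q'| ≤ |p - p'| * Q + P * |q - q'| := by
  have h1 : p * q - p' * q' = (p - p') * q + p' * (q - q') := by ring
  rw [h1]
  refine (abs_add_le _ _).trans ?_
  rw [abs_mul, abs_mul]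
  gcongr

lemma abs_pairFst_sub_le (a b a' b' : ℝ) :
    |pairFst a b - pairFst a' b'| ≤ 16 * Real.pi * |a - a'| + 8 * |b - b'| := by
  have key : ∀ a b a' b' : ℝ, |dPsi a * Phi b - dPsi a' * Phi b'|
      ≤ 8 * Real.pi * |a - a'| + 4 * |b - b'| := by
    intro a b a' b'
    have h1 := abs_mul_sub_mul_le (p := dPsi a) (q := Phi b) (p' := dPsi a') (q' := Phi b')
      (P := 1) (Q := 4 * Real.pi)
      (by rw [abs_of_nonneg (dPsi_nonneg _)]; exact dPsi_le_one _)
      (by rw [abs_of_pos (Phi_pos _)]; exact (Phi_lt _).le)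
    have h2 := mul_le_mul_of_nonneg_right (abs_dPsi_sub_le a a')
      (by positivity : 0 ≤ 4 * Real.pi)
    linarith [abs_Phi_sub_le b b']
  have h1 := key a b a' b'
  have h2 := key (-a) (-b) (-a') (-b')
  have e1 : |(-a) - (-a')| = |a - a'| := by rw [← abs_neg]; congr 1; ring
  have e2 : |(-b) - (-b')| = |b - b'| := by rw [← abs_neg]; congr 1; ring
  rw [e1, e2] at h2
  unfold pairFst
  rw [abs_le] at *
  constructor <;> linarith [h1.1, h1.2, h2.1, h2.2]

lemma abs_pairSnd_sub_le (a b a' b' : ℝ) :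
    |pairSnd a b - pairSnd a' b'| ≤ 8 * |a - a'| + 4 * |b - b'| := by
  have h0 : |(Psi (-a) + Psi a) - (Psi (-a') + Psi a')| ≤ 2 * |a - a'| := by
    have h1 := abs_Psi_sub_le a a'
    have h2 := abs_Psi_sub_le (-a) (-a')
    have e1 : |(-a) - (-a')| = |a - a'| := by rw [← abs_neg]; congr 1; ring
    rw [e1] at h2
    rw [abs_le] at *
    constructor <;> linarith [h1.1, h1.2, h2.1, h2.2]
  have h1 := abs_mul_sub_mul_le (p := Psi (-a) + Psi a) (q := dPhi b) (p' := Psi (-a') + Psi a')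
    (q' := dPhi b') (P := 1) (Q := 4)
    (by rw [abs_of_nonneg (Psi_neg_add_Psi_nonneg _)]; exact Psi_neg_add_Psi_le_one _)
    (by rw [abs_of_pos (dPhi_pos _)]; exact dPhi_le _)
  have h2 := abs_dPhi_sub_le b b'
  have h3 : pairSnd a b - pairSnd a' b' =
      -((Psi (-a) + Psi a) * dPhi b - (Psi (-a') + Psi a') * dPhi b') := by
    unfold pairSnd; ring
  rw [h3, abs_neg]
  linarith

lemma hasFDerivAt_pair {E : Type*} [NormedAddCommGroup E] [NormedSpace ℝ E] (l l' : E →L[ℝ] ℝ)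
    (z : E) :
    HasFDerivAt (fun z => pair (l z) (l' z))
      (pairFst (l z) (l' z) • l + pairSnd (l z) (l' z) • l') z := by
  have a1 := (hasDerivAt_Psi (l z)).comp_hasFDerivAt z l.hasFDerivAt
  have a2 := (hasDerivAt_Phi (l' z)).comp_hasFDerivAt z l'.hasFDerivAt
  have a3 := (hasDerivAt_Psi ((-l) z)).comp_hasFDerivAt z (-l).hasFDerivAt
  have a4 := (hasDerivAt_Phi ((-l') z)).comp_hasFDerivAt z (-l').hasFDerivAt
  refine ((a3.mul a4).sub (a1.mul a2)).congr_fderiv ?_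
  ext v
  simp [pairFst, pairSnd, dPhi_neg]
  ring

/-! ### Weighted chains of coupled coordinates -/

lemma coord_succ_of_lt {d : ℕ} (z : EuclideanSpace ℝ (Fin d)) {k : ℕ} (hk : k < d) :
    coord z (k + 1) = z ⟨k, hk⟩ := by
  simp [coord, hk]

lemma coord_succ_of_le {d : ℕ} (z : EuclideanSpace ℝ (Fin d)) {k : ℕ} (hk : d ≤ k) :
    coord z (k + 1) = 0 := by
  simp [coord, hk]

/-- The coordinate number `k + 1` as a continuous linear functional. -/
def coordL (d k : ℕ) : EuclideanSpace ℝ (Fin d) →L[ℝ] ℝ :=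
  if hk : k < d then EuclideanSpace.proj (⟨k, hk⟩ : Fin d) else 0

lemma coordL_apply {d : ℕ} (k : ℕ) (z : EuclideanSpace ℝ (Fin d)) :
    coordL d k z = coord z (k + 1) := by
  unfold coordL
  split_ifs with hk
  · simp [coord_succ_of_lt z hk]
  · simp [coord_succ_of_le z (not_lt.1 hk)]

lemma coord_sub {d : ℕ} (z z' : EuclideanSpace ℝ (Fin d)) (k : ℕ) :
    coord (z - z') (k + 1) = coord z (k + 1) - coord z' (k + 1) := by
  simp only [← coordL_apply, map_sub]

lemma sum_coord_sq {d : ℕ} (z : EuclideanSpace ℝ (Fin d)) :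
    ∑ k ∈ Finset.range d, coord z (k + 1) ^ 2 = ‖z‖ ^ 2 := by
  rw [EuclideanSpace.real_norm_sq_eq, Finset.sum_range]
  exact Finset.sum_congr rfl fun k _ => by rw [coord_succ_of_lt z k.2]

/-- `φ(z, 1) + ∑_{k ≥ 1} W_k φ(z, k + 1)`. -/
def chain (W : ℕ → ℝ) {d : ℕ} (z : EuclideanSpace ℝ (Fin d)) : ℝ :=
  -Psi 1 * Phi (coord z 1) +
    ∑ k ∈ Finset.range (d - 1), W (k + 1) * pair (coord z (k + 1)) (coord z (k + 2))

/-- The partial derivatives of `chain W`. -/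
def chainPartial (W : ℕ → ℝ) {d : ℕ} (z : EuclideanSpace ℝ (Fin d)) (k : ℕ) : ℝ :=
  (if k = 0 then -Psi 1 * dPhi (coord z 1) else W k * pairSnd (coord z k) (coord z (k + 1))) +
    (if k + 1 < d then W (k + 1) * pairFst (coord z (k + 1)) (coord z (k + 2)) else 0)

def chainGrad (W : ℕ → ℝ) {d : ℕ} (z : EuclideanSpace ℝ (Fin d)) : EuclideanSpace ℝ (Fin d) :=
  WithLp.toLp 2 fun k => chainPartial W z k

lemma hasGradientAt_chain (W : ℕ → ℝ) {d : ℕ} (hd : 0 < d) (z : EuclideanSpace ℝ (Fin d)) :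
    HasGradientAt (chain W) (chainGrad W z) z := by
  obtain ⟨n, rfl⟩ : ∃ n, d = n + 1 := ⟨d - 1, by omega⟩
  rw [hasGradientAt_iff_hasFDerivAt]
  have h0 : HasFDerivAt (fun z : EuclideanSpace ℝ (Fin (n + 1)) => -Psi 1 * Phi (coordL (n + 1) 0 z))
      (-Psi 1 • (dPhi (coordL (n + 1) 0 z) • coordL (n + 1) 0)) z :=
    ((hasDerivAt_Phi (coordL (n + 1) 0 z)).comp_hasFDerivAt z
      (coordL (n + 1) 0).hasFDerivAt).const_mul (-Psi 1)
  have h1 : HasFDerivAt (fun z : EuclideanSpace ℝ (Fin (n + 1)) => ∑ k ∈ Finset.range n,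
      W (k + 1) * pair (coordL (n + 1) k z) (coordL (n + 1) (k + 1) z)) _ z :=
    HasFDerivAt.fun_sum fun k _ =>
      (hasFDerivAt_pair (coordL (n + 1) k) (coordL (n + 1) (k + 1)) z).const_mul (W (k + 1))
  have h2 := h0.fun_add h1
  simp only [coordL_apply] at h2
  refine h2.congr_fderiv ?_
  ext v
  have h3 : (InnerProductSpace.toDual ℝ _ (chainGrad W z)) v
      = ∑ k ∈ Finset.range (n + 1), chainPartial W z k * coord v (k + 1) := by
    rw [InnerProductSpace.toDual_apply_apply, Finset.sum_range, PiLp.inner_apply]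
    refine Finset.sum_congr rfl fun k _ => ?_
    rw [coord_succ_of_lt v k.2]
    simp [chainGrad, mul_comm]
  rw [h3]
  simp only [chainPartial, add_mul, Finset.sum_add_distrib]
  -- Coordinate `k` is the second argument of one pair and the first argument of the next. Splitting
  -- off the initial term of one sum and the final term of the other aligns both with the sum over
  -- the `n` pairs.
  rw [Finset.sum_range_succ', Finset.sum_range_succ _ n]
  simp only [add_apply, smul_apply, sum_apply, coordL_apply, smul_eq_mul, lt_irrefl, if_false, zero_mul,
    add_zero, if_true, Nat.succ_ne_zero]
  have h4 : ∀ k ∈ Finset.range n, (if k + 1 < n + 1 then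
      W (k + 1) * pairFst (coord z (k + 1)) (coord z (k + 2)) else 0) * coord v (k + 1)
      = W (k + 1) * pairFst (coord z (k + 1)) (coord z (k + 2)) * coord v (k + 1) := by
    intro k hk
    rw [if_pos (by simpa using hk)]
  rw [Finset.sum_congr rfl h4]
  simp only [mul_add, Finset.sum_add_distrib, zero_add, mul_assoc]
  ring

/-- The two parts contribute at most `3 · 4π` and `3 · 4`. The bound `25π` is the source of `50π` in
the condition on `β`. -/
lemma abs_chainPartial_le {W : ℕ → ℝ} (hW0 : ∀ k, 0 ≤ W k) (hW3 : ∀ k, W k ≤ 3)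
    {d : ℕ} (z : EuclideanSpace ℝ (Fin d)) (k : ℕ) :
    |chainPartial W z k| ≤ 25 * Real.pi := by
  have hpi := Real.pi_gt_three
  have key : ∀ k p q, 0 ≤ q → -q ≤ p → p ≤ 0 → -(3 * q) ≤ W k * p ∧ W k * p ≤ 0 := by
    intro k p q hq h1 h2
    have := hW0 k
    have := hW3 k
    constructor <;> nlinarith
  have h1 : -(12 * Real.pi) ≤ (if k + 1 < d then
        W (k + 1) * pairFst (coord z (k + 1)) (coord z (k + 2)) else 0) ∧
      (if k + 1 < d then W (k + 1) * pairFst (coord z (k + 1)) (coord z (k + 2)) else 0) ≤ 0 := by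
    split_ifs
    · obtain ⟨h, h'⟩ := key (k + 1) _ (4 * Real.pi) (by positivity) (pairFst_ge (coord z (k + 1))
        (coord z (k + 2))) (pairFst_nonpos _ _)
      exact ⟨by linarith, h'⟩
    · exact ⟨by linarith, le_rfl⟩
  have h2 : -12 ≤ (if k = 0 then -Psi 1 * dPhi (coord z 1)
        else W k * pairSnd (coord z k) (coord z (k + 1))) ∧
      (if k = 0 then -Psi 1 * dPhi (coord z 1)
        else W k * pairSnd (coord z k) (coord z (k + 1))) ≤ 0 := by
    split_ifs
    · have a1 := Psi_nonneg 1
      have a2 := Psi_le_one 1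
      have a3 := dPhi_pos (coord z 1)
      have a4 := dPhi_le (coord z 1)
      constructor <;> nlinarith
    · obtain ⟨h, h'⟩ := key k _ 4 (by positivity) (pairSnd_ge (coord z k)
        (coord z (k + 1))) (pairSnd_nonpos _ _)
      exact ⟨by linarith, h'⟩
  unfold chainPartial
  rw [abs_le]
  constructor <;> linarith [h1.1, h1.2, h2.1, h2.2]

lemma abs_chainPartial_sub_le {W : ℕ → ℝ} (hW0 : ∀ k, 0 ≤ W k) (hW3 : ∀ k, W k ≤ 3)
    {d : ℕ} (z z' : EuclideanSpace ℝ (Fin d)) (k : ℕ) :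
    |chainPartial W z k - chainPartial W z' k| ≤
      (48 * Real.pi + 12) * |coord (z - z') (k + 1)|
        + 24 * (if k = 0 then 0 else |coord (z - z') k|) + 24 * |coord (z - z') (k + 2)| := by
  have hpi := Real.pi_gt_three
  have h1 : |(if k + 1 < d then W (k + 1) * pairFst (coord z (k + 1)) (coord z (k + 2)) else 0)
        - (if k + 1 < d then W (k + 1) * pairFst (coord z' (k + 1)) (coord z' (k + 2)) else 0)|
      ≤ 48 * Real.pi * |coord (z - z') (k + 1)| + 24 * |coord (z - z') (k + 2)| := by
    split_ifs
    · rw [← mul_sub, abs_mul, abs_of_nonneg (hW0 _), coord_sub, coord_sub z z' (k + 1)]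
      have a1 := abs_pairFst_sub_le (coord z (k + 1)) (coord z (k + 2)) (coord z' (k + 1))
        (coord z' (k + 2))
      have a2 := mul_le_mul (hW3 (k + 1)) a1 (abs_nonneg _) (by norm_num)
      linarith
    · simp only [sub_zero, abs_zero]
      positivity
  have h2 : |(if k = 0 then -Psi 1 * dPhi (coord z 1)
          else W k * pairSnd (coord z k) (coord z (k + 1)))
        - (if k = 0 then -Psi 1 * dPhi (coord z' 1)
          else W k * pairSnd (coord z' k) (coord z' (k + 1)))|
      ≤ 12 * |coord (z - z') (k + 1)| + 24 * (if k = 0 then 0 else |coord (z - z') k|) := by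
    split_ifs with hk
    · subst hk
      rw [← mul_sub, abs_mul, abs_neg, abs_of_nonneg (Psi_nonneg _), coord_sub]
      have a1 := abs_dPhi_sub_le (coord z 1) (coord z' 1)
      have a2 := mul_le_mul (Psi_le_one 1) a1 (abs_nonneg _) (by norm_num)
      have a3 := abs_nonneg (coord z 1 - coord z' 1)
      simp only [zero_add, mul_zero, add_zero]
      linarith
    · obtain ⟨j, rfl⟩ : ∃ j, k = j + 1 := ⟨k - 1, by omega⟩
      rw [← mul_sub, abs_mul, abs_of_nonneg (hW0 _), coord_sub, coord_sub z z' j]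
      have a1 := abs_pairSnd_sub_le (coord z (j + 1)) (coord z (j + 1 + 1)) (coord z' (j + 1))
        (coord z' (j + 1 + 1))
      have a2 := mul_le_mul (hW3 (j + 1)) a1 (abs_nonneg _) (by norm_num)
      linarith
  unfold chainPartial
  rw [add_sub_add_comm]
  refine (abs_add_le _ _).trans ?_
  linarith

/-- The Jacobian is tridiagonal with row sums at most `48π + 12 + 24 + 24 ≤ 75π`. Raising the
diagonal coefficient to `75π - 48` makes the row sum exactly `75π`; convexity of the square, then
summation over rows, gives the bound, since index shifts do not increase the sum of squares. -/
lemma norm_chainGrad_sub_le {W : ℕ → ℝ} (hW0 : ∀ k, 0 ≤ W k) (hW3 : ∀ k, W k ≤ 3)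
    {d : ℕ} (z z' : EuclideanSpace ℝ (Fin d)) :
    ‖chainGrad W z - chainGrad W z'‖ ≤ 75 * Real.pi * ‖z - z'‖ := by
  have hpi := Real.pi_gt_three
  refine abs_le_of_sq_le_sq' ?_ (by positivity) |>.2
  have e1 : ‖chainGrad W z - chainGrad W z'‖ ^ 2
      = ∑ k ∈ Finset.range d, (chainPartial W z k - chainPartial W z' k) ^ 2 := by
    rw [EuclideanSpace.real_norm_sq_eq, Finset.sum_range]
    rfl
  set D : ℕ → ℝ := fun k => coord (z - z') (k + 1)
  set D' : ℕ → ℝ := fun k => if k = 0 then 0 else coord (z - z') k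
  have hD : ∑ k ∈ Finset.range d, D k ^ 2 = ‖z - z'‖ ^ 2 := sum_coord_sq (z - z')
  have hD1 : ∑ k ∈ Finset.range d, D (k + 1) ^ 2 ≤ ‖z - z'‖ ^ 2 := by
    rw [← hD]
    rcases d with _ | n
    · simp
    rw [Finset.sum_range_succ, Finset.sum_range_succ' (fun k => D k ^ 2)]
    have : D (n + 1) = 0 := coord_succ_of_le _ le_rfl
    rw [this]
    have := sq_nonneg (D 0)
    linarith
  have hD2 : ∑ k ∈ Finset.range d, D' k ^ 2 ≤ ‖z - z'‖ ^ 2 := by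
    rw [← hD]
    rcases d with _ | n
    · simp
    rw [Finset.sum_range_succ', Finset.sum_range_succ (fun k => D k ^ 2)]
    have : D' 0 = 0 := by simp [D']
    rw [this]
    have := sq_nonneg (D n)
    have e : ∀ k ∈ Finset.range n, D' (k + 1) ^ 2 = D k ^ 2 := fun k _ => by simp [D', D]
    rw [Finset.sum_congr rfl e]
    linarith
  have hterm : ∀ k ∈ Finset.range d, (chainPartial W z k - chainPartial W z' k) ^ 2 ≤
      (75 * Real.pi) * ((75 * Real.pi - 48) * D k ^ 2 + 24 * D' k ^ 2 + 24 * D (k + 1) ^ 2) := by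
    intro k _
    have h1 := abs_chainPartial_sub_le hW0 hW3 z z' k
    have e2 : (if k = 0 then 0 else |coord (z - z') k|) = |D' k| := by
      simp only [D']; split_ifs <;> simp
    rw [e2] at h1
    have h2 : |chainPartial W z k - chainPartial W z' k| ≤
        (75 * Real.pi - 48) * |D k| + 24 * |D' k| + 24 * |D (k + 1)| := by
      refine h1.trans ?_
      have : (48 * Real.pi + 12) * |D k| ≤ (75 * Real.pi - 48) * |D k| :=
        mul_le_mul_of_nonneg_right (by linarith) (abs_nonneg _)
      exact add_le_add (add_le_add this le_rfl) le_rfl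
    rw [← sq_abs]
    refine (pow_le_pow_left₀ (abs_nonneg _) h2 2).trans ?_
    rw [← sq_abs (D k), ← sq_abs (D' k), ← sq_abs (D (k + 1))]
    generalize |D k| = u
    generalize |D' k| = v
    generalize |D (k + 1)| = w
    have hc : 0 ≤ 75 * Real.pi - 48 := by linarith
    generalize hcc : 75 * Real.pi - 48 = c at *
    have : 75 * Real.pi = c + 48 := by linarith
    rw [this]
    nlinarith [mul_nonneg hc (sq_nonneg (u - v)), mul_nonneg hc (sq_nonneg (u - w)),
      sq_nonneg (v - w)]
  rw [e1, mul_pow]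
  refine (Finset.sum_le_sum hterm).trans ?_
  rw [← Finset.mul_sum, Finset.sum_add_distrib, Finset.sum_add_distrib, ← Finset.mul_sum,
    ← Finset.mul_sum, ← Finset.mul_sum, hD]
  have : (75 * Real.pi - 48) * ‖z - z'‖ ^ 2 + 24 * ∑ k ∈ Finset.range d, D' k ^ 2
      + 24 * ∑ k ∈ Finset.range d, D (k + 1) ^ 2 ≤ 75 * Real.pi * ‖z - z'‖ ^ 2 := by linarith
  calc _ ≤ 75 * Real.pi * (75 * Real.pi * ‖z - z'‖ ^ 2) :=
        mul_le_mul_of_nonneg_left this (by positivity)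
    _ = _ := by ring

lemma chain_ge {W : ℕ → ℝ} (hW0 : ∀ k, 0 ≤ W k) {d : ℕ} (z : EuclideanSpace ℝ (Fin d)) :
    -(4 * Real.pi) - 4 * Real.pi * ∑ k ∈ Finset.range (d - 1), W (k + 1) ≤ chain W z := by
  unfold chain
  have h1 : -(4 * Real.pi) ≤ -Psi 1 * Phi (coord z 1) := by
    have := mul_le_mul (Psi_le_one 1) (Phi_lt (coord z 1)).le (Phi_pos _).le zero_le_one
    linarith
  have h2 : -(4 * Real.pi * ∑ k ∈ Finset.range (d - 1), W (k + 1)) ≤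
      ∑ k ∈ Finset.range (d - 1), W (k + 1) * pair (coord z (k + 1)) (coord z (k + 2)) := by
    rw [Finset.mul_sum, ← Finset.sum_neg_distrib]
    refine Finset.sum_le_sum fun k _ => ?_
    have := mul_le_mul_of_nonneg_left (pair_ge (coord z (k + 1)) (coord z (k + 2))) (hW0 (k + 1))
    linarith
  linarith

lemma chain_zero_nonpos (W : ℕ → ℝ) {d : ℕ} : chain W (0 : EuclideanSpace ℝ (Fin d)) ≤ 0 := by
  have h0 : ∀ k, coord (0 : EuclideanSpace ℝ (Fin d)) (k + 1) = 0 := fun k => by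
    rw [← coordL_apply, map_zero]
  have h1 := mul_nonneg (Psi_nonneg 1) (Phi_pos (coord (0 : EuclideanSpace ℝ (Fin d)) 1)).le
  simp only [chain, h0, pair_zero, mul_zero, Finset.sum_const_zero, add_zero]
  linarith [h0 0, mul_nonneg (Psi_nonneg 1) (Phi_pos 0).le]

/-- As long as the last coordinate is small, the chain with unit weights has a large partial
derivative. -/
lemma exists_chainPartial_one_lt {d : ℕ} (hd : 0 < d) (z : EuclideanSpace ℝ (Fin d))
    (hz : |coord z d| < 1) : ∃ k < d, chainPartial (fun _ => 1) z k < -1 := by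
  have hex : ∃ k, |coord z (k + 1)| < 1 := ⟨d - 1, by rwa [Nat.sub_add_cancel hd]⟩
  classical
  -- The earliest coordinate of size below one: its predecessor, if any, has size at least one, so
  -- `pairSnd` is below `-1`, while `pairFst` only lowers the sum.
  set k := Nat.find hex with hk
  have h1 : |coord z (k + 1)| < 1 := Nat.find_spec hex
  have hkd : k < d := by
    have : k ≤ d - 1 := Nat.find_le (by rwa [Nat.sub_add_cancel hd])
    omega
  refine ⟨k, hkd, ?_⟩
  have h2 : (if k + 1 < d then (1 : ℝ) * pairFst (coord z (k + 1)) (coord z (k + 2)) else 0) ≤ 0 := by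
    split_ifs
    · rw [one_mul]; exact pairFst_nonpos _ _
    · exact le_rfl
  have h3 : (if k = 0 then -Psi 1 * dPhi (coord z 1)
      else 1 * pairSnd (coord z k) (coord z (k + 1))) < -1 := by
    split_ifs with h0
    · rw [h0] at h1
      nlinarith [Psi_one_gt_half, two_lt_dPhi h1]
    · rw [one_mul]
      refine pairSnd_lt_neg_one ?_ h1
      have := Nat.find_min hex (m := k - 1) (by omega)
      rw [not_lt, Nat.sub_add_cancel (Nat.pos_of_ne_zero h0)] at this
      exact this
  unfold chainPartial
  linarith

/-! ### The component functions as chains -/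

/-- The weight of `φ(·, k + 1)` in `h_{i+1}`, for `k ≥ 1` and `N = m / 3`. -/
def weight (N i k : ℕ) : ℝ :=
  if i < N then (if Odd k then 3 else 0)
  else if i < 2 * N then 0
  else (if Odd k then 0 else 3)

lemma weight_nonneg (N i k : ℕ) : 0 ≤ weight N i k := by
  unfold weight; split_ifs <;> norm_num

lemma weight_le (N i k : ℕ) : weight N i k ≤ 3 := by
  unfold weight; split_ifs <;> norm_num

/-- For either parity exactly one outer third carries the weight 3, so the weights average to one
over the blocks. -/
lemma sum_weight (N k : ℕ) : ∑ i : Fin (3 * N), weight N i k = 3 * N := by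
  rw [← Finset.sum_range (fun i => weight N i k)]
  have e : 3 * N = N + N + N := by ring
  rw [e, Finset.sum_range_add, Finset.sum_range_add]
  have h1 : ∑ i ∈ Finset.range N, weight N i k = ∑ i ∈ Finset.range N, if Odd k then 3 else 0 :=
    Finset.sum_congr rfl fun i hi => by simp [weight, Finset.mem_range.1 hi]
  have h2 : ∑ i ∈ Finset.range N, weight N (N + i) k = ∑ i ∈ Finset.range N, (0 : ℝ) :=
    Finset.sum_congr rfl fun i hi => by
      have := Finset.mem_range.1 hi
      simp [weight, two_mul, this]
  have h3 : ∑ i ∈ Finset.range N, weight N (N + N + i) k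
      = ∑ i ∈ Finset.range N, if Odd k then 0 else 3 :=
    Finset.sum_congr rfl fun i hi => by
      have a1 : ¬ (N + N + i < N) := by omega
      have a2 : ¬ (N + N + i < 2 * N) := by omega
      simp [weight, a1, a2]
  rw [h1, h2, h3]
  split_ifs <;> simp [mul_comm]

lemma phi_one {d : ℕ} (z : EuclideanSpace ℝ (Fin d)) : phi z 1 = -Psi 1 * Phi (coord z 1) := by
  simp [phi]

lemma phi_add_two {d : ℕ} (z : EuclideanSpace ℝ (Fin d)) (k : ℕ) :
    phi z (k + 2) = pair (coord z (k + 1)) (coord z (k + 2)) := by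
  simp [phi, pair]

lemma sum_range_odd_succ (F : ℕ → ℝ) (q : ℕ) :
    ∑ k ∈ Finset.range (2 * q), (if Odd (k + 1) then 3 else 0) * F (k + 2)
      = 3 * ∑ j ∈ Finset.Icc 1 q, F (2 * j) := by
  induction q with
  | zero => simp
  | succ q ih =>
    rw [Finset.sum_Icc_succ_top (by omega), mul_add 3, ← ih, show 2 * (q + 1) = 2 * q + 1 + 1 by ring,
      Finset.sum_range_succ, Finset.sum_range_succ]
    have h1 : Odd (2 * q + 1) := ⟨q, rfl⟩
    have h2 : ¬ Odd (2 * q + 1 + 1) := by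
      rw [Nat.not_odd_iff_even]; exact ⟨q + 1, by ring⟩
    simp only [h1, h2, if_true, if_false]
    ring_nf

lemma sum_range_even_succ (F : ℕ → ℝ) (q : ℕ) :
    ∑ k ∈ Finset.range (2 * q), (if Odd (k + 1) then 0 else 3) * F (k + 2)
      = 3 * ∑ j ∈ Finset.Icc 1 q, F (2 * j + 1) := by
  induction q with
  | zero => simp
  | succ q ih =>
    rw [Finset.sum_Icc_succ_top (by omega), mul_add 3, ← ih, show 2 * (q + 1) = 2 * q + 1 + 1 by ring,
      Finset.sum_range_succ, Finset.sum_range_succ]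
    have h1 : Odd (2 * q + 1) := ⟨q, rfl⟩
    have h2 : ¬ Odd (2 * q + 1 + 1) := by
      rw [Nat.not_odd_iff_even]; exact ⟨q + 1, by ring⟩
    simp only [h1, h2, if_true, if_false]
    ring_nf

/-- For `d = 2q + 1` the indices `2j` and `2j + 1` with `1 ≤ j ≤ q` exhaust the `2q` pairs. An odd
`k` in `weight` corresponds to the even index `k + 1` of `φ`. -/
lemma h_eq_chain (m₁ m₂ : ℕ) {d : ℕ} (hd : Odd d) (i : ℕ) (z : EuclideanSpace ℝ (Fin d)) :
    h m₁ m₂ (i + 1) z = chain (weight (m₁ * m₂) i) z := by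
  obtain ⟨q, rfl⟩ := hd
  have e1 : (2 * q + 1) / 2 = q := by omega
  have e2 : 2 * q + 1 - 1 = 2 * q := by omega
  unfold h chain weight
  simp only [← phi_one, ← phi_add_two, Nat.succ_le_iff, e1, e2]
  split_ifs
  · rw [sum_range_odd_succ]
  · simp
  · rw [sum_range_even_succ]

/-! ### Smoothness of the hard instance -/

/-- The factor by which the argument of `h_i` is scaled. -/
def argScale (m₁ m₂ : ℕ) (ε L : ℝ) : ℝ :=
  √(numBlocks m₁ m₂ : ℝ) * L / (150 * Real.pi * ε)

/-- The factor in front of the scaled gradient of `h_i`. -/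
def gradScale (m₁ m₂ : ℕ) (ε : ℝ) : ℝ := 2 * ε / √(numBlocks m₁ m₂ : ℝ)

def hardGrad (m₁ m₂ : ℕ) {d : ℕ} (ε L : ℝ)
    (x : EuclideanSpace ℝ (Fin (numBlocks m₁ m₂) × Fin d)) :
    EuclideanSpace ℝ (Fin (numBlocks m₁ m₂) × Fin d) :=
  WithLp.toLp 2 fun p => gradScale m₁ m₂ ε *
    chainPartial (weight (m₁ * m₂) p.1) (argScale m₁ m₂ ε L • block x p.1) p.2

lemma numBlocks_pos {m₁ m₂ : ℕ} (hm₁ : 2 ≤ m₁) (hm₂ : 1 ≤ m₂) :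
    (0 : ℝ) < (numBlocks m₁ m₂ : ℝ) := by
  have : 0 < numBlocks m₁ m₂ := by unfold numBlocks; positivity
  exact_mod_cast this

lemma scale_mul_argScale {m₁ m₂ : ℕ} {ε L : ℝ} (hε : 0 < ε) (hL : 0 < L)
    (hm : (0 : ℝ) < (numBlocks m₁ m₂ : ℝ)) :
    300 * Real.pi * ε ^ 2 / ((numBlocks m₁ m₂ : ℝ) * L) * argScale m₁ m₂ ε L
      = gradScale m₁ m₂ ε := by
  unfold argScale gradScale
  have hs : 0 < √(numBlocks m₁ m₂ : ℝ) := Real.sqrt_pos.2 hm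
  have hpi := Real.pi_pos
  have hsq : √(numBlocks m₁ m₂ : ℝ) ^ 2 = (numBlocks m₁ m₂ : ℝ) := Real.sq_sqrt hm.le
  generalize √(numBlocks m₁ m₂ : ℝ) = s at *
  rw [← hsq]
  field_simp
  norm_num

lemma gradScale_mul_argScale {m₁ m₂ : ℕ} {ε L : ℝ} (hε : 0 < ε)
    (hm : (0 : ℝ) < (numBlocks m₁ m₂ : ℝ)) :
    gradScale m₁ m₂ ε * (75 * Real.pi * argScale m₁ m₂ ε L) = L := by
  unfold argScale gradScale
  have hs : 0 < √(numBlocks m₁ m₂ : ℝ) := Real.sqrt_pos.2 hm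
  have hpi := Real.pi_pos
  field_simp
  ring

lemma gradScale_pos {m₁ m₂ : ℕ} {ε : ℝ} (hε : 0 < ε) (hm : (0 : ℝ) < (numBlocks m₁ m₂ : ℝ)) :
    0 < gradScale m₁ m₂ ε := by
  unfold gradScale
  have hs : 0 < √(numBlocks m₁ m₂ : ℝ) := Real.sqrt_pos.2 hm
  positivity

lemma argScale_pos {m₁ m₂ : ℕ} {ε L : ℝ} (hε : 0 < ε) (hL : 0 < L)
    (hm : (0 : ℝ) < (numBlocks m₁ m₂ : ℝ)) : 0 < argScale m₁ m₂ ε L := by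
  unfold argScale
  have hs : 0 < √(numBlocks m₁ m₂ : ℝ) := Real.sqrt_pos.2 hm
  have := Real.pi_pos
  positivity

/-- `block` as a continuous linear map. -/
def blockL {m d : ℕ} (i : Fin m) :
    EuclideanSpace ℝ (Fin m × Fin d) →L[ℝ] EuclideanSpace ℝ (Fin d) :=
  LinearMap.toContinuousLinearMap
    { toFun := fun x => block x i
      map_add' := fun _ _ => rfl
      map_smul' := fun _ _ => rfl }

lemma block_sub {m d : ℕ} (i : Fin m) (x x' : EuclideanSpace ℝ (Fin m × Fin d)) :
    block (x - x') i = block x i - block x' i := rfl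

lemma sum_norm_block_sq {m d : ℕ} (x : EuclideanSpace ℝ (Fin m × Fin d)) :
    ∑ i, ‖block x i‖ ^ 2 = ‖x‖ ^ 2 := by
  rw [EuclideanSpace.real_norm_sq_eq, Fintype.sum_prod_type]
  refine Finset.sum_congr rfl fun i _ => ?_
  rw [EuclideanSpace.real_norm_sq_eq]
  rfl

lemma hardInstance_f₀_eq {m₁ m₂ d : ℕ} {ε L β : ℝ} (hd : Odd d) :
    (hardInstance m₁ m₂ d ε L β).f₀ = fun x => ∑ i : Fin (numBlocks m₁ m₂),
      300 * Real.pi * ε ^ 2 / ((numBlocks m₁ m₂ : ℝ) * L) *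
        chain (weight (m₁ * m₂) i) ((argScale m₁ m₂ ε L • blockL i) x) := by
  funext x
  simp only [hardInstance, f, h_eq_chain m₁ m₂ hd]
  rfl

lemma hasGradientAt_f₀ {m₁ m₂ d : ℕ} {ε L β : ℝ} (hε : 0 < ε) (hL : 0 < L)
    (hm : (0 : ℝ) < (numBlocks m₁ m₂ : ℝ)) (hd : Odd d) (x : EuclideanSpace ℝ (VarIdx m₁ m₂ d)) :
    HasGradientAt (hardInstance m₁ m₂ d ε L β).f₀ (hardGrad m₁ m₂ ε L x) x := by
  rw [hardInstance_f₀_eq hd, hasGradientAt_iff_hasFDerivAt]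
  have h1 : HasFDerivAt (fun x : EuclideanSpace ℝ (VarIdx m₁ m₂ d) =>
      ∑ i : Fin (numBlocks m₁ m₂),
      300 * Real.pi * ε ^ 2 / ((numBlocks m₁ m₂ : ℝ) * L) *
        chain (weight (m₁ * m₂) i) ((argScale m₁ m₂ ε L • blockL i) x)) _ x :=
    HasFDerivAt.fun_sum fun i _ =>
      (((hasGradientAt_iff_hasFDerivAt.1 (hasGradientAt_chain (weight (m₁ * m₂) i) hd.pos
        ((argScale m₁ m₂ ε L • blockL i) x))).comp x
          (argScale m₁ m₂ ε L • blockL i).hasFDerivAt).const_mul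
            (300 * Real.pi * ε ^ 2 / ((numBlocks m₁ m₂ : ℝ) * L)))
  refine h1.congr_fderiv ?_
  ext v
  rw [InnerProductSpace.toDual_apply_apply, PiLp.inner_apply, Fintype.sum_prod_type, sum_apply]
  refine Finset.sum_congr rfl fun i _ => ?_
  rw [smul_apply, ContinuousLinearMap.comp_apply, InnerProductSpace.toDual_apply_apply,
    PiLp.inner_apply, smul_eq_mul, Finset.mul_sum]
  refine Finset.sum_congr rfl fun k _ => ?_
  have e : ((argScale m₁ m₂ ε L • blockL i) v) k = argScale m₁ m₂ ε L * v (i, k) := rfl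
  have e2 : (argScale m₁ m₂ ε L • blockL i) x = argScale m₁ m₂ ε L • block x i := rfl
  have e3 : hardGrad m₁ m₂ ε L x (i, k) = gradScale m₁ m₂ ε *
    chainPartial (weight (m₁ * m₂) i) (argScale m₁ m₂ ε L • block x i) k := rfl
  have e4 : chainGrad (weight (m₁ * m₂) i) (argScale m₁ m₂ ε L • block x i) k =
    chainPartial (weight (m₁ * m₂) i) (argScale m₁ m₂ ε L • block x i) k := rfl
  rw [e2]
  simp only [RCLike.inner_apply, conj_trivial, e, e3, e4]
  rw [← scale_mul_argScale hε hL hm]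
  ring

lemma gradient_f₀ {m₁ m₂ d : ℕ} {ε L β : ℝ} (hε : 0 < ε) (hL : 0 < L)
    (hm : (0 : ℝ) < (numBlocks m₁ m₂ : ℝ)) (hd : Odd d) (x : EuclideanSpace ℝ (VarIdx m₁ m₂ d)) :
    gradient (hardInstance m₁ m₂ d ε L β).f₀ x = hardGrad m₁ m₂ ε L x :=
  (hasGradientAt_f₀ hε hL hm hd x).gradient

/-- The scalings are chosen so that `75π` becomes exactly `L`. This serves both the smoothness of
`f₀` and the comparison of the blocks at a stationary point. -/
lemma norm_scaled_chainGrad_sub_le {m₁ m₂ d : ℕ} {ε L : ℝ} (hε : 0 < ε) (hL : 0 < L)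
    (hm : (0 : ℝ) < (numBlocks m₁ m₂ : ℝ)) (i : ℕ) (z z' : EuclideanSpace ℝ (Fin d)) :
    gradScale m₁ m₂ ε * ‖chainGrad (weight (m₁ * m₂) i) (argScale m₁ m₂ ε L • z)
      - chainGrad (weight (m₁ * m₂) i) (argScale m₁ m₂ ε L • z')‖ ≤ L * ‖z - z'‖ := by
  have h1 := norm_chainGrad_sub_le (weight_nonneg (m₁ * m₂) i) (weight_le (m₁ * m₂) i)
    (argScale m₁ m₂ ε L • z) (argScale m₁ m₂ ε L • z')
  rw [← smul_sub, norm_smul, Real.norm_of_nonneg (argScale_pos hε hL hm).le] at h1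
  calc _ ≤ gradScale m₁ m₂ ε * (75 * Real.pi * (argScale m₁ m₂ ε L * ‖z - z'‖)) :=
        mul_le_mul_of_nonneg_left h1 (gradScale_pos hε hm).le
    _ = gradScale m₁ m₂ ε * (75 * Real.pi * argScale m₁ m₂ ε L) * ‖z - z'‖ := by ring
    _ = _ := by rw [gradScale_mul_argScale hε hm]

lemma block_hardGrad {m₁ m₂ d : ℕ} (ε L : ℝ) (x : EuclideanSpace ℝ (VarIdx m₁ m₂ d))
    (i : Fin (numBlocks m₁ m₂)) :
    block (hardGrad m₁ m₂ ε L x) i = gradScale m₁ m₂ ε •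
      chainGrad (weight (m₁ * m₂) i) (argScale m₁ m₂ ε L • block x i) := rfl

lemma isSmoothWith_f₀ {m₁ m₂ d : ℕ} {ε L β : ℝ} (hε : 0 < ε) (hL : 0 < L)
    (hm : (0 : ℝ) < (numBlocks m₁ m₂ : ℝ)) (hd : Odd d) :
    IsSmoothWith L (hardInstance m₁ m₂ d ε L β).f₀ := by
  refine ⟨fun x => (hasGradientAt_f₀ hε hL hm hd x).differentiableAt, fun x x' => ?_⟩
  rw [gradient_f₀ hε hL hm hd, gradient_f₀ hε hL hm hd]
  refine abs_le_of_sq_le_sq' ?_ (by positivity) |>.2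
  rw [mul_pow, ← sum_norm_block_sq, ← sum_norm_block_sq (x - x'), Finset.mul_sum]
  refine Finset.sum_le_sum fun i _ => ?_
  rw [← mul_pow]
  refine pow_le_pow_left₀ (norm_nonneg _) ?_ 2
  rw [block_sub, block_sub, block_hardGrad, block_hardGrad, ← smul_sub, norm_smul,
    Real.norm_of_nonneg (gradScale_pos hε hm).le]
  exact norm_scaled_chainGrad_sub_le hε hL hm i _ _

/-! ### The initial gap -/

lemma hardInstance_F₀_eq {m₁ m₂ d : ℕ} {ε L β : ℝ} (x : EuclideanSpace ℝ (VarIdx m₁ m₂ d)) :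
    (hardInstance m₁ m₂ d ε L β).F₀ x = (((hardInstance m₁ m₂ d ε L β).f₀ x +
      β / ((numBlocks m₁ m₂ : ℝ) * L) *
        ∑ k, |(hardInstance m₁ m₂ d ε L β).Abar.toEuclideanLin x k| : ℝ) : EReal) := by
  simp [Problem.F₀, Problem.g, hardInstance]

/-- Each unit of weight costs at most `4π`. Since the weights sum to `m` at every link, the total is
`4π m d`, and the prefactor `300 π ε² / (m L)` turns it into `1200 π² ε² d / L`. -/
lemma f₀_ge {m₁ m₂ d : ℕ} {ε L β : ℝ} (hL : 0 < L)
    (hm : (0 : ℝ) < (numBlocks m₁ m₂ : ℝ)) (hd : Odd d) (x : EuclideanSpace ℝ (VarIdx m₁ m₂ d)) :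
    -(1200 * Real.pi ^ 2 * ε ^ 2 * d / L) ≤ (hardInstance m₁ m₂ d ε L β).f₀ x := by
  have hpi := Real.pi_pos
  rw [hardInstance_f₀_eq hd]
  have hC : 0 ≤ 300 * Real.pi * ε ^ 2 / ((numBlocks m₁ m₂ : ℝ) * L) := by positivity
  have h1 : ∑ i : Fin (numBlocks m₁ m₂), (-(4 * Real.pi)
      - 4 * Real.pi * ∑ k ∈ Finset.range (d - 1), weight (m₁ * m₂) i (k + 1))
      = -(4 * Real.pi * ((numBlocks m₁ m₂ : ℝ) * d)) := by
    have e : (numBlocks m₁ m₂ : ℕ) = 3 * (m₁ * m₂) := by unfold numBlocks; ring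
    rw [Finset.sum_sub_distrib, ← Finset.mul_sum, Finset.sum_comm]
    have e2 : ∀ k, ∑ i : Fin (numBlocks m₁ m₂), weight (m₁ * m₂) i (k + 1)
        = (numBlocks m₁ m₂ : ℝ) := by
      intro k
      rw [e]
      simpa using sum_weight (m₁ * m₂) (k + 1)
    simp only [e2, Finset.sum_const, Finset.card_univ, Fintype.card_fin, Finset.card_range,
      nsmul_eq_mul]
    rw [Nat.cast_sub hd.pos]
    push_cast
    ring
  have h2 : -(4 * Real.pi * ((numBlocks m₁ m₂ : ℝ) * d)) ≤ ∑ i : Fin (numBlocks m₁ m₂),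
      chain (weight (m₁ * m₂) i) ((argScale m₁ m₂ ε L • blockL i) x) := by
    rw [← h1]
    exact Finset.sum_le_sum fun i _ => chain_ge (weight_nonneg _ _) _
  have h3 := mul_le_mul_of_nonneg_left h2 hC
  rw [Finset.mul_sum] at h3
  refine le_trans (le_of_eq ?_) h3
  field_simp
  ring

lemma f₀_zero_nonpos {m₁ m₂ d : ℕ} {ε L β : ℝ} (hL : 0 < L) (hd : Odd d) :
    (hardInstance m₁ m₂ d ε L β).f₀ 0 ≤ 0 := by
  have hpi := Real.pi_pos
  rw [hardInstance_f₀_eq hd]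
  refine Finset.sum_nonpos fun i _ => ?_
  rw [map_zero]
  exact mul_nonpos_of_nonneg_of_nonpos (by positivity) (chain_zero_nonpos _)

lemma le_iInf_F₀ {m₁ m₂ d : ℕ} {ε L β : ℝ} (hL : 0 < L) (hβ : 0 ≤ β)
    (hm : (0 : ℝ) < (numBlocks m₁ m₂ : ℝ)) (hd : Odd d) :
    ((-(1200 * Real.pi ^ 2 * ε ^ 2 * d / L) : ℝ) : EReal) ≤
      ⨅ x, (hardInstance m₁ m₂ d ε L β).F₀ x := by
  refine le_iInf fun x => ?_
  rw [hardInstance_F₀_eq, EReal.coe_le_coe_iff]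
  have h1 := f₀_ge (ε := ε) (β := β) hL hm hd x
  have h2 : 0 ≤ β / ((numBlocks m₁ m₂ : ℝ) * L) *
        ∑ k, |(hardInstance m₁ m₂ d ε L β).Abar.toEuclideanLin x k| := by positivity
  linarith

lemma gap_le {m₁ m₂ d : ℕ} {ε L β : ℝ} (hL : 0 < L) (hβ : 0 ≤ β)
    (hm : (0 : ℝ) < (numBlocks m₁ m₂ : ℝ)) (hd : Odd d) :
    (hardInstance m₁ m₂ d ε L β).gap 0 ≤ 1200 * Real.pi ^ 2 * ε ^ 2 * d / L := by
  set B := 1200 * Real.pi ^ 2 * ε ^ 2 * d / L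
  have hinf := le_iInf_F₀ (ε := ε) hL hβ hm hd
  have h0 : (hardInstance m₁ m₂ d ε L β).F₀ 0 =
      (((hardInstance m₁ m₂ d ε L β).f₀ 0 : ℝ) : EReal) := by
    rw [hardInstance_F₀_eq]
    simp
  have hle : (hardInstance m₁ m₂ d ε L β).F₀ 0 - (⨅ x, (hardInstance m₁ m₂ d ε L β).F₀ x)
      ≤ ((B : ℝ) : EReal) := by
    refine (EReal.sub_le_sub (y := ((0 : ℝ) : EReal)) ?_ hinf).trans (le_of_eq ?_)
    · rw [h0, EReal.coe_le_coe_iff]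
      exact f₀_zero_nonpos hL hd
    · rw [← EReal.coe_sub]
      simp [B]
  have hB : (0 : ℝ) ≤ B := by positivity
  -- Monotonicity of `toReal` needs a difference other than `⊥`; at `⊥` the value of `toReal` is 0.
  rcases le_or_gt ((hardInstance m₁ m₂ d ε L β).F₀ 0 -
      (⨅ x, (hardInstance m₁ m₂ d ε L β).F₀ x)) ⊥ with hbot | hbot
  · unfold Problem.gap
    rw [le_bot_iff.1 hbot]
    simpa using hB
  · exact EReal.toReal_le_toReal hle hbot.ne' (EReal.coe_ne_top _)

/-! ### Membership in the problem class -/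

lemma isConvexFun_coe {E : Type*} [AddCommGroup E] [Module ℝ E] {g : E → ℝ}
    (hg : ConvexOn ℝ Set.univ g) : IsConvexFun fun y => (g y : EReal) := by
  have := hg.convex_epigraph
  simpa [IsConvexFun, EReal.coe_le_coe_iff] using this

lemma convexOn_mul_sum_abs {κ : Type*} [Fintype κ] {c : ℝ} (hc : 0 ≤ c) :
    ConvexOn ℝ Set.univ fun y : EuclideanSpace ℝ κ => c * ∑ k, |y k| := by
  refine ⟨convex_univ, fun y _ w _ a b ha hb _ => ?_⟩
  have h1 : ∑ k, |(a • y + b • w) k| ≤ a * ∑ k, |y k| + b * ∑ k, |w k| := by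
    rw [Finset.mul_sum, Finset.mul_sum, ← Finset.sum_add_distrib]
    refine Finset.sum_le_sum fun k _ => ?_
    refine (abs_add_le _ _).trans (le_of_eq ?_)
    simp [abs_mul, abs_of_nonneg ha, abs_of_nonneg hb]
  have := mul_le_mul_of_nonneg_left h1 hc
  simp only [smul_eq_mul]
  linarith

/-- Without a row in `Ā` the space of `y` would be a point and the domain of `ḡ` a singleton. The
witness is row number `m₁`, which has index `m₁ - 1`. -/
lemma nonempty_regIdx {m₁ m₂ d : ℕ} (hm₁ : 2 ≤ m₁) (hm₂ : 1 ≤ m₂) (hd : Odd d) :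
    Nonempty (RegIdx m₁ m₂ d) := by
  have h1 : m₁ - 1 < numBlocks m₁ m₂ - 1 := by
    have : 2 * m₁ ≤ numBlocks m₁ m₂ := by
      unfold numBlocks
      nlinarith
    omega
  refine ⟨⟨⟨⟨m₁ - 1, h1⟩, ?_⟩, ⟨0, hd.pos⟩⟩⟩
  simp only [rowsM, Finset.mem_filter, Finset.mem_univ, true_and, Finset.mem_image, Finset.mem_Icc]
  exact ⟨1, ⟨le_rfl, by omega⟩, by omega⟩

theorem hardInstance_inClass {m₁ m₂ d : ℕ} {ε L β : ℝ} (hε : 0 < ε) (hL : 0 < L) (hβ : 0 ≤ β)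
    (hm₁ : 2 ≤ m₁) (hm₂ : 1 ≤ m₂) (hd : Odd d) : (hardInstance m₁ m₂ d ε L β).InClass L := by
  have hm := numBlocks_pos hm₁ hm₂
  have hdom : effDom (hardInstance m₁ m₂ d ε L β).gbar = Set.univ :=
    Set.eq_univ_of_forall fun y => EReal.coe_ne_top _
  have hc : 0 ≤ β / ((numBlocks m₁ m₂ : ℝ) * L) := by positivity
  refine ⟨(EReal.bot_lt_coe _).trans_le (le_iInf_F₀ hL hβ hm hd), isSmoothWith_f₀ hε hL hm hd,
    ⟨fun y => EReal.coe_ne_bot _, by rw [hdom]; exact Set.univ_nonempty⟩, ?_,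
    isConvexFun_coe (convexOn_mul_sum_abs hc), ?_, ?_⟩
  · refine Continuous.lowerSemicontinuous ?_
    refine continuous_coe_real_ereal.comp ?_
    fun_prop
  · rw [hdom]
    exact Set.Nonempty.intrinsicInterior convex_univ Set.univ_nonempty
  · rintro ⟨y, hy⟩
    rw [hdom] at hy
    obtain ⟨k⟩ := nonempty_regIdx hm₁ hm₂ hd
    have h1 : y + EuclideanSpace.single k (1 : ℝ) ∈ ({y} : Set _) := hy ▸ Set.mem_univ _
    rw [Set.mem_singleton_iff, add_eq_left] at h1
    simpa using congrArg (fun v => v k) h1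

/-! ### The difference matrices -/

/-- The adjoint of the difference operator: `w_{i-1} - w_i`, with `w_{-1} = 0`. -/
def backDiff (w : ℕ → ℝ) (i : ℕ) : ℝ := (if i = 0 then 0 else w (i - 1)) - w i

/-- Telescoping recovers a multiplier from partial sums; both the eigenvalue bound and the
stationarity argument rest on it. -/
lemma sum_range_backDiff (w : ℕ → ℝ) (n : ℕ) :
    ∑ i ∈ Finset.range (n + 1), backDiff w i = -w n := by
  induction n with
  | zero => simp [backDiff]
  | succ n ih =>
    rw [Finset.sum_range_succ, ih]
    simp only [backDiff, Nat.succ_ne_zero, if_false, Nat.add_sub_cancel]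
    ring

lemma sum_backDiff_sq_le (w : ℕ → ℝ) (n : ℕ) (hw : w n = 0) :
    ∑ i ∈ Finset.range (n + 1), backDiff w i ^ 2 ≤ 4 * ∑ r ∈ Finset.range n, w r ^ 2 := by
  have h1 : ∀ i ∈ Finset.range (n + 1), backDiff w i ^ 2 ≤
      2 * (if i = 0 then 0 else w (i - 1)) ^ 2 + 2 * w i ^ 2 := by
    intro i _
    unfold backDiff
    nlinarith [sq_nonneg ((if i = 0 then 0 else w (i - 1)) + w i)]
  refine (Finset.sum_le_sum h1).trans ?_
  rw [Finset.sum_add_distrib, ← Finset.mul_sum, ← Finset.mul_sum, Finset.sum_range_succ',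
    Finset.sum_range_succ (fun i => w i ^ 2)]
  simp only [Nat.succ_ne_zero, if_false, if_true, hw, Nat.add_sub_cancel]
  apply le_of_eq
  ring

lemma sq_sum_range_le {v : ℕ → ℝ} {k m : ℕ} (hk : k ≤ m) :
    (∑ i ∈ Finset.range k, v i) ^ 2 ≤ m * ∑ i ∈ Finset.range m, v i ^ 2 := by
  refine (sq_sum_le_card_mul_sum_sq (s := Finset.range k) (f := v)).trans ?_
  rw [Finset.card_range]
  refine mul_le_mul (by exact_mod_cast hk) ?_ (Finset.sum_nonneg fun _ _ => sq_nonneg _)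
    (Nat.cast_nonneg _)
  exact Finset.sum_le_sum_of_subset_of_nonneg (Finset.range_subset_range.2 hk)
    fun _ _ _ => sq_nonneg _

/-- A discrete Poincaré inequality: each `w r` is minus a partial sum of differences, to which
Cauchy-Schwarz applies. -/
lemma sum_sq_le_sum_backDiff_sq (w : ℕ → ℝ) (n : ℕ) :
    ∑ r ∈ Finset.range n, w r ^ 2 ≤
      ((n + 1 : ℕ) : ℝ) ^ 2 * ∑ i ∈ Finset.range (n + 1), backDiff w i ^ 2 := by
  have h1 : ∀ r ∈ Finset.range n, w r ^ 2 ≤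
      ((n + 1 : ℕ) : ℝ) * ∑ i ∈ Finset.range (n + 1), backDiff w i ^ 2 := by
    intro r hr
    have h2 : w r ^ 2 = (∑ i ∈ Finset.range (r + 1), backDiff w i) ^ 2 := by
      rw [sum_range_backDiff, neg_sq]
    rw [h2]
    exact sq_sum_range_le (by have := Finset.mem_range.1 hr; omega)
  refine (Finset.sum_le_sum h1).trans ?_
  rw [Finset.sum_const, Finset.card_range, nsmul_eq_mul, sq, mul_assoc]
  refine mul_le_mul_of_nonneg_right (by push_cast; linarith) ?_
  exact mul_nonneg (Nat.cast_nonneg _) (Finset.sum_nonneg fun _ _ => sq_nonneg _)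

/-- Column `i` of `J` has `1` in row `i - 1` and `-1` in row `i`. Extending `w` by zero past the
last row covers the last column without a separate case. -/
lemma sum_J_mul (p : ℕ) (w : ℕ → ℝ) (hw : ∀ r, p - 1 ≤ r → w r = 0) (i : Fin p) :
    ∑ r : Fin (p - 1), J p r i * w r = backDiff w i := by
  have h1 : ∀ r ∈ Finset.univ, J p r i * w (r : Fin (p - 1)).val =
      (if i.val = r.val + 1 then w r else 0) - (if i.val = r.val then w r else 0) := by
    intro r _
    simp only [J, Matrix.of_apply]
    split_ifs with a b <;> first | omega | simp
  rw [Finset.sum_congr rfl h1, Finset.sum_sub_distrib,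
    ← Finset.sum_range (fun r => if i.val = r + 1 then w r else 0),
    ← Finset.sum_range (fun r => if i.val = r then w r else 0), Finset.sum_ite_eq]
  unfold backDiff
  congr 1
  · split_ifs with h0
    · refine Finset.sum_eq_zero fun r _ => if_neg (by omega)
    · have : ∀ r ∈ Finset.range (p - 1), (if i.val = r + 1 then w r else 0) =
          if i.val - 1 = r then w r else 0 := fun r _ => by
        congr 1
        apply propext
        omega
      rw [Finset.sum_congr rfl this, Finset.sum_ite_eq, if_pos]
      have := i.2
      simp only [Finset.mem_range]
      omega
  · split_ifs with h0
    · rfl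
    · exact (hw _ (by simpa using h0)).symm

lemma J_mulVec (p : ℕ) (r : Fin (p - 1)) (v : Fin p → ℝ) (hr : r.val < p) (hr' : r.val + 1 < p) :
    ∑ i, J p r i * v i = v ⟨r.val + 1, hr'⟩ - v ⟨r.val, hr⟩ := by
  have h1 : ∀ i ∈ Finset.univ, J p r i * v i =
      (if i = ⟨r.val + 1, hr'⟩ then v i else 0) - (if i = ⟨r.val, hr⟩ then v i else 0) := by
    intro i _
    simp only [J, Matrix.of_apply, Fin.ext_iff]
    split_ifs with a b <;> first | omega | simp
  rw [Finset.sum_congr rfl h1, Finset.sum_sub_distrib]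
  simp

/-! ### Spectral bounds for the stacked difference matrix -/

section rows

variable {m₁ m₂ d : ℕ}

/-- Multipliers of both sets of rows, merged into one sequence (zero beyond the last row). -/
def mergeRows (z₁ : RegIdx m₁ m₂ d → ℝ) (z₂ : ConIdx m₁ m₂ d → ℝ) (j : Fin d) (r : ℕ) : ℝ :=
  if hr : r < numBlocks m₁ m₂ - 1 then
    if hM : (⟨r, hr⟩ : Fin (numBlocks m₁ m₂ - 1)) ∈ rowsM m₁ m₂ then z₁ (⟨_, hM⟩, j)
    else z₂ (⟨_, hM⟩, j)
  else 0

lemma mergeRows_of_le (z₁ : RegIdx m₁ m₂ d → ℝ) (z₂ : ConIdx m₁ m₂ d → ℝ) (j : Fin d) {r : ℕ}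
    (hr : numBlocks m₁ m₂ - 1 ≤ r) : mergeRows z₁ z₂ j r = 0 := dif_neg (not_lt.2 hr)

lemma mergeRows_reg (z₁ : RegIdx m₁ m₂ d → ℝ) (z₂ : ConIdx m₁ m₂ d → ℝ) (j : Fin d)
    (r : {r // r ∈ rowsM m₁ m₂}) : mergeRows z₁ z₂ j r.1 = z₁ (r, j) := by
  simp [mergeRows, r.1.2, r.2]

lemma mergeRows_con (z₁ : RegIdx m₁ m₂ d → ℝ) (z₂ : ConIdx m₁ m₂ d → ℝ) (j : Fin d)
    (r : {r // r ∉ rowsM m₁ m₂}) : mergeRows z₁ z₂ j r.1 = z₂ (r, j) := by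
  simp [mergeRows, r.1.2, r.2]

/-- Rows of a submatrix of `m L J ⊗ I`, with row set a subtype. -/
lemma kron_transpose_mulVec {q : Fin (numBlocks m₁ m₂ - 1) → Prop} [Fintype {r // q r}] (c : ℝ)
    (z : {r // q r} × Fin d → ℝ) (i : Fin (numBlocks m₁ m₂)) (j : Fin d) :
    ((c • ((J (numBlocks m₁ m₂)).submatrix (Subtype.val : {r // q r} → _) id ⊗ₖ
      (1 : Matrix (Fin d) (Fin d) ℝ)))ᵀ *ᵥ z) (i, j)
      = c * ∑ r : {r // q r}, J (numBlocks m₁ m₂) r.1 i * z (r, j) := by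
  simp only [Matrix.mulVec, dotProduct, Matrix.transpose_apply, Matrix.smul_apply,
    Matrix.kroneckerMap_apply, Matrix.submatrix_apply, id, Fintype.sum_prod_type,
    Matrix.one_apply, smul_eq_mul, Finset.mul_sum]
  refine Finset.sum_congr rfl fun r _ => ?_
  simp [mul_assoc]

lemma kron_mulVec {q : Fin (numBlocks m₁ m₂ - 1) → Prop} (c : ℝ)
    (x : Fin (numBlocks m₁ m₂) × Fin d → ℝ) (r : {r // q r}) (j : Fin d)
    (hr : r.1.val < numBlocks m₁ m₂) (hr' : r.1.val + 1 < numBlocks m₁ m₂) :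
    ((c • ((J (numBlocks m₁ m₂)).submatrix (Subtype.val : {r // q r} → _) id ⊗ₖ
      (1 : Matrix (Fin d) (Fin d) ℝ))) *ᵥ x) (r, j)
      = c * (x (⟨r.1.val + 1, hr'⟩, j) - x (⟨r.1.val, hr⟩, j)) := by
  rw [← J_mulVec _ r.1 (fun i => x (i, j)) hr hr']
  simp only [Matrix.mulVec, dotProduct, Matrix.smul_apply,
    Matrix.kroneckerMap_apply, Matrix.submatrix_apply, id, Fintype.sum_prod_type,
    Matrix.one_apply, smul_eq_mul, Finset.mul_sum]
  refine Finset.sum_congr rfl fun i _ => ?_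
  simp [mul_assoc]

/-- Interleaving the rows of `Ā` and `A` restores the full matrix `J`, so the way the rows are
divided no longer matters. -/
lemma transpose_mulVec_add (L : ℝ) (z₁ : RegIdx m₁ m₂ d → ℝ) (z₂ : ConIdx m₁ m₂ d → ℝ)
    (i : Fin (numBlocks m₁ m₂)) (j : Fin d) :
    ((hardAbar m₁ m₂ d L)ᵀ *ᵥ z₁) (i, j) + ((hardA m₁ m₂ d L)ᵀ *ᵥ z₂) (i, j)
      = (numBlocks m₁ m₂ : ℝ) * L * backDiff (mergeRows z₁ z₂ j) i := by
  have e₁ := kron_transpose_mulVec ((numBlocks m₁ m₂ : ℝ) * L) z₁ i j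
  have e₂ := kron_transpose_mulVec ((numBlocks m₁ m₂ : ℝ) * L) z₂ i j
  refine (congrArg₂ (· + ·) e₁ e₂).trans ?_
  rw [← mul_add,
    ← sum_J_mul _ _ (fun r hr => mergeRows_of_le z₁ z₂ j hr),
    ← Fintype.sum_subtype_add_sum_subtype (fun r => r ∈ rowsM m₁ m₂)]
  congr 2
  · exact Finset.sum_congr (by ext; simp) fun r _ => by rw [mergeRows_reg]
  · exact Finset.sum_congr rfl fun r _ => by rw [mergeRows_con]

lemma sum_mergeRows_sq (z₁ : RegIdx m₁ m₂ d → ℝ) (z₂ : ConIdx m₁ m₂ d → ℝ) :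
    ∑ j, ∑ r ∈ Finset.range (numBlocks m₁ m₂ - 1), mergeRows z₁ z₂ j r ^ 2
      = ∑ p, z₁ p ^ 2 + ∑ p, z₂ p ^ 2 := by
  rw [Fintype.sum_prod_type_right, Fintype.sum_prod_type_right, ← Finset.sum_add_distrib]
  refine Finset.sum_congr rfl fun j _ => ?_
  rw [Finset.sum_range, ← Fintype.sum_subtype_add_sum_subtype (fun r => r ∈ rowsM m₁ m₂)]
  congr 1
  · exact Finset.sum_congr (by ext; simp) fun r _ => by rw [mergeRows_reg]
  · exact Finset.sum_congr rfl fun r _ => by rw [mergeRows_con]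

/-- For an eigenvector `u` one has `‖Mᵀ u‖² = μ ‖u‖²`, and `Mᵀ u` is `m L` times the differences of
the merged sequence. The Poincaré bound with constant `m²` and the bound `4` of `sum_backDiff_sq_le`
enclose `μ`. -/
lemma eigenvalue_bounds {L : ℝ} (hm : 0 < numBlocks m₁ m₂) {μ : ℝ}
    (hμ : Module.End.HasEigenvalue (Matrix.toLin'
      (Matrix.fromRows (hardAbar m₁ m₂ d L) (hardA m₁ m₂ d L) *
        (Matrix.fromRows (hardAbar m₁ m₂ d L) (hardA m₁ m₂ d L))ᵀ)) μ) :
    L ^ 2 ≤ μ ∧ μ ≤ 4 * ((numBlocks m₁ m₂ : ℝ) * L) ^ 2 := by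
  obtain ⟨u, hu⟩ := hμ.exists_hasEigenvector
  set M := Matrix.fromRows (hardAbar m₁ m₂ d L) (hardA m₁ m₂ d L) with hM
  have h1 : M *ᵥ (Mᵀ *ᵥ u) = μ • u := by
    rw [Matrix.mulVec_mulVec, ← Matrix.toLin'_apply]
    exact hu.apply_eq_smul
  have h2 : (Mᵀ *ᵥ u) ⬝ᵥ (Mᵀ *ᵥ u) = μ * (u ⬝ᵥ u) := by
    rw [Matrix.mulVec_transpose, ← Matrix.dotProduct_mulVec, ← Matrix.mulVec_transpose, h1,
      dotProduct_smul, smul_eq_mul]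
  have hpos : 0 < u ⬝ᵥ u := by
    have := dotProduct_self_eq_zero (v := u)
    have h0 : 0 ≤ u ⬝ᵥ u := Finset.sum_nonneg fun k _ => mul_self_nonneg _
    exact lt_of_le_of_ne h0 fun h => hu.2 (this.1 h.symm)
  set z₁ := u ∘ Sum.inl
  set z₂ := u ∘ Sum.inr
  obtain ⟨n, hn⟩ : ∃ n, numBlocks m₁ m₂ = n + 1 := ⟨numBlocks m₁ m₂ - 1, by omega⟩
  have hn' : numBlocks m₁ m₂ - 1 = n := by omega
  have h3 : u ⬝ᵥ u = ∑ j, ∑ r ∈ Finset.range n, mergeRows z₁ z₂ j r ^ 2 := by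
    rw [← hn', sum_mergeRows_sq]
    simp [dotProduct, Fintype.sum_sum_type, z₁, z₂, sq]
  have h4 : (Mᵀ *ᵥ u) ⬝ᵥ (Mᵀ *ᵥ u) = ((numBlocks m₁ m₂ : ℝ) * L) ^ 2 *
      ∑ j, ∑ i ∈ Finset.range (n + 1), backDiff (mergeRows z₁ z₂ j) i ^ 2 := by
    rw [dotProduct, Fintype.sum_prod_type_right, Finset.mul_sum]
    refine Finset.sum_congr rfl fun j _ => ?_
    rw [← hn, Finset.sum_range, Finset.mul_sum]
    refine Finset.sum_congr rfl fun i _ => ?_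
    have e : (Mᵀ *ᵥ u) (i, j) =
        (numBlocks m₁ m₂ : ℝ) * L * backDiff (mergeRows z₁ z₂ j) i := by
      rw [← transpose_mulVec_add, hM, Matrix.transpose_fromRows, Matrix.fromCols_mulVec]
      rfl
    rw [e]
    ring
  have hz : ∀ j, mergeRows z₁ z₂ j n = 0 := fun j => mergeRows_of_le _ _ _ hn'.le
  rw [h2] at h4
  constructor
  · have h5 : u ⬝ᵥ u ≤ (numBlocks m₁ m₂ : ℝ) ^ 2 *
        ∑ j, ∑ i ∈ Finset.range (n + 1), backDiff (mergeRows z₁ z₂ j) i ^ 2 := by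
      rw [h3, Finset.mul_sum]
      refine Finset.sum_le_sum fun j _ => ?_
      rw [hn]
      exact sum_sq_le_sum_backDiff_sq _ n
    refine le_of_mul_le_mul_right ?_ hpos
    rw [h4, mul_pow, mul_comm (_ ^ 2) (L ^ 2), mul_assoc]
    exact mul_le_mul_of_nonneg_left h5 (sq_nonneg L)
  · refine le_of_mul_le_mul_right ?_ hpos
    rw [h4, h3, mul_comm 4, mul_assoc]
    refine mul_le_mul_of_nonneg_left ?_ (sq_nonneg _)
    rw [Finset.mul_sum]
    exact Finset.sum_le_sum fun j _ => sum_backDiff_sq_le _ n (hz j)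

lemma condNumber_le {L : ℝ} (hL : 0 < L) (hm : 0 < numBlocks m₁ m₂) :
    condNumber (Matrix.fromRows (hardAbar m₁ m₂ d L) (hardA m₁ m₂ d L))
      ≤ 2 * (numBlocks m₁ m₂ : ℝ) := by
  unfold condNumber
  set S := {μ : ℝ | Module.End.HasEigenvalue (Matrix.toLin'
      (Matrix.fromRows (hardAbar m₁ m₂ d L) (hardA m₁ m₂ d L) *
        (Matrix.fromRows (hardAbar m₁ m₂ d L) (hardA m₁ m₂ d L))ᵀ)) μ}
  have hm0 : (0 : ℝ) ≤ numBlocks m₁ m₂ := Nat.cast_nonneg _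
  rw [Real.sqrt_le_left (by positivity)]
  set S' := {μ : ℝ | Module.End.HasEigenvalue (Matrix.toLin'
      (Matrix.fromRows (hardAbar m₁ m₂ d L) (hardA m₁ m₂ d L) *
        (Matrix.fromRows (hardAbar m₁ m₂ d L) (hardA m₁ m₂ d L))ᵀ)) μ ∧ 0 < μ}
  -- If there were no positive eigenvalue, the infimum would be 0 by convention, and so would the
  -- quotient.
  rcases S'.eq_empty_or_nonempty with h0 | h0
  · rw [h0, Real.sInf_empty, div_zero]
    positivity
  · have h1 : L ^ 2 ≤ sInf S' := le_csInf h0 fun μ hμ => (eigenvalue_bounds hm hμ.1).1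
    have h2 : sSup S ≤ 4 * ((numBlocks m₁ m₂ : ℝ) * L) ^ 2 :=
      Real.sSup_le (fun μ hμ => (eigenvalue_bounds hm hμ).2) (by positivity)
    have hL2 : 0 < L ^ 2 := by positivity
    rw [div_le_iff₀ (hL2.trans_le h1)]
    calc _ ≤ _ := h2
      _ = (2 * (numBlocks m₁ m₂ : ℝ)) ^ 2 * L ^ 2 := by ring
      _ ≤ _ := mul_le_mul_of_nonneg_left h1 (by positivity)

/-- Row number 1 belongs to `A` because `m₁ ≥ 2`, and it meets block 0 with entry `-m L`. This lets
the term `‖A‖` in the condition on `β` absorb `m L ε`. -/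
lemma le_specNorm_hardA {L : ℝ} (hL : 0 < L) (hm₁ : 2 ≤ m₁) (hm₂ : 1 ≤ m₂) (hd : 0 < d) :
    (numBlocks m₁ m₂ : ℝ) * L ≤ specNorm (hardA m₁ m₂ d L) := by
  have hm : 2 < numBlocks m₁ m₂ := by
    unfold numBlocks
    nlinarith
  have hrow : (⟨0, by omega⟩ : Fin (numBlocks m₁ m₂ - 1)) ∉ rowsM m₁ m₂ := by
    simp only [rowsM, Finset.mem_filter, Finset.mem_univ, true_and, Finset.mem_image,
      Finset.mem_Icc, not_exists, not_and]
    intro i hi h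
    nlinarith [hi.1]
  set e : EuclideanSpace ℝ (VarIdx m₁ m₂ d) :=
    EuclideanSpace.single (⟨0, by omega⟩, ⟨0, hd⟩) 1 with he
  have h1 := (LinearMap.toContinuousLinearMap
    (Matrix.toEuclideanLin (hardA m₁ m₂ d L))).le_opNorm e
  have h2 : ‖e‖ = 1 := by simp [he]
  rw [h2, mul_one] at h1
  refine le_trans ?_ h1
  refine le_trans (le_of_eq ?_) (PiLp.norm_apply_le _ (⟨_, hrow⟩, ⟨0, hd⟩))
  have h3 : (Matrix.toEuclideanLin (hardA m₁ m₂ d L) e) (⟨_, hrow⟩, ⟨0, hd⟩) =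
      -((numBlocks m₁ m₂ : ℝ) * L) := by
    rw [Matrix.toLpLin_apply]
    refine (kron_mulVec _ e.ofLp ⟨_, hrow⟩ ⟨0, hd⟩ (by simp; omega) (by simp; omega)).trans ?_
    simp [he]
  have h4 : (0 : ℝ) ≤ (numBlocks m₁ m₂ : ℝ) * L := by positivity
  rw [LinearMap.coe_toContinuousLinearMap', h3, norm_neg, Real.norm_of_nonneg h4]

end rows

/-! ### The zero-chain property -/

/-- A lower bound for the first iteration at which coordinate `k` of block `i` can be nonzero. -/
def arrival (N i k : ℕ) : ℕ :=
  if k = 0 then 0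
  else if Odd k then (k - 1) * N + (i + 1 - N)
  else (k - 1) * N + (2 * N - i)

/-- With the next lemma: arrival times of adjacent blocks differ by at most one, matching the
one-block reach of `A` and `Ā` per iteration. -/
lemma arrival_succ_le (N i k : ℕ) : arrival N (i + 1) k ≤ arrival N i k + 1 := by
  unfold arrival; split_ifs <;> omega

lemma arrival_le_succ (N i k : ℕ) : arrival N i k ≤ arrival N (i + 1) k + 1 := by
  unfold arrival; split_ifs <;> omega

/-- For `k ≥ 2`, where the weight is nonzero, coordinate `k - 1` comes from the opposite outer
third. It arrives no earlier than `(k - 1) N + 1`, while `arrival` is `(k - 1) N` for `k`. For `k =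
1` both times are 0. -/
lemma arrival_le_of_weight {N i k : ℕ} (hk : k ≠ 0) (hw : weight N i k ≠ 0) :
    arrival N i k ≤ arrival N i (k - 1) + 1 := by
  obtain ⟨l, rfl⟩ : ∃ l, k = l + 1 := ⟨k - 1, by omega⟩
  simp only [Nat.add_sub_cancel]
  have hodd : Odd (l + 1) ↔ ¬ Odd l := Nat.odd_add_one
  by_cases h1 : i < N
  · have ho : Odd (l + 1) := by
      by_contra ho
      simp [weight, h1, ho] at hw
    have hl : ¬ Odd l := hodd.1 ho
    rcases Nat.eq_zero_or_pos l with h0 | h0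
    · subst h0
      simp [arrival]
      omega
    · obtain ⟨p, rfl⟩ : ∃ p, l = p + 1 := ⟨l - 1, by omega⟩
      simp only [arrival, Nat.succ_ne_zero, if_false, ho, hl, if_true, Nat.add_sub_cancel, add_mul]
      omega
  · by_cases h2 : i < 2 * N
    · simp [weight, h1, h2] at hw
    · have ho : ¬ Odd (l + 1) := by
        intro ho
        simp [weight, h1, h2, ho] at hw
      have hl : Odd l := by
        by_contra hl
        exact ho (hodd.2 hl)
      obtain ⟨p, rfl⟩ : ∃ p, l = p + 1 := ⟨l - 1, by have := hl.pos; omega⟩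
      simp only [arrival, Nat.succ_ne_zero, if_false, ho, hl, if_true, Nat.add_sub_cancel, add_mul]
      omega

lemma le_arrival {N i k : ℕ} : (k - 1) * N ≤ arrival N i k := by
  unfold arrival
  split_ifs with h
  · simp [h]
  · omega
  · omega

section support

variable {m₁ m₂ d : ℕ}

lemma kron_transpose_mulVec_eq_zero {q : Fin (numBlocks m₁ m₂ - 1) → Prop} [Fintype {r // q r}]
    (c : ℝ) (z : {r // q r} × Fin d → ℝ) (i : Fin (numBlocks m₁ m₂)) (j : Fin d)
    (hz : ∀ r : {r // q r}, i.val = r.1.val ∨ i.val = r.1.val + 1 → z (r, j) = 0) :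
    ((c • ((J (numBlocks m₁ m₂)).submatrix (Subtype.val : {r // q r} → _) id ⊗ₖ
      (1 : Matrix (Fin d) (Fin d) ℝ)))ᵀ *ᵥ z) (i, j) = 0 := by
  rw [kron_transpose_mulVec, Finset.sum_eq_zero, mul_zero]
  intro r _
  by_cases hr : i.val = r.1.val ∨ i.val = r.1.val + 1
  · rw [hz r hr, mul_zero]
  · rw [not_or] at hr
    simp [J, hr.1, hr.2]

lemma row_lt (r : Fin (numBlocks m₁ m₂ - 1)) : r.val < numBlocks m₁ m₂ := by
  have := r.2; omega

lemma row_succ_lt (r : Fin (numBlocks m₁ m₂ - 1)) : r.val + 1 < numBlocks m₁ m₂ := by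
  have := r.2; omega

lemma hardAbar_apply (L : ℝ) (x : EuclideanSpace ℝ (VarIdx m₁ m₂ d))
    (r : {r // r ∈ rowsM m₁ m₂}) (j : Fin d) :
    (hardAbar m₁ m₂ d L).toEuclideanLin x (r, j) = (numBlocks m₁ m₂ : ℝ) * L *
      (x (⟨r.1.val + 1, row_succ_lt r.1⟩, j) - x (⟨r.1.val, row_lt r.1⟩, j)) :=
  kron_mulVec _ x.ofLp r j (row_lt r.1) (row_succ_lt r.1)

lemma hardA_apply (L : ℝ) (x : EuclideanSpace ℝ (VarIdx m₁ m₂ d))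
    (r : {r // r ∉ rowsM m₁ m₂}) (j : Fin d) :
    (hardA m₁ m₂ d L).toEuclideanLin x (r, j) = (numBlocks m₁ m₂ : ℝ) * L *
      (x (⟨r.1.val + 1, row_succ_lt r.1⟩, j) - x (⟨r.1.val, row_lt r.1⟩, j)) :=
  kron_mulVec _ x.ofLp r j (row_lt r.1) (row_succ_lt r.1)

lemma hardAbar_transpose_eq_zero (L : ℝ) (z : EuclideanSpace ℝ (RegIdx m₁ m₂ d))
    (i : Fin (numBlocks m₁ m₂)) (j : Fin d)
    (hz : ∀ r : {r // r ∈ rowsM m₁ m₂}, i.val = r.1.val ∨ i.val = r.1.val + 1 → z (r, j) = 0) :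
    (hardAbar m₁ m₂ d L)ᵀ.toEuclideanLin z (i, j) = 0 :=
  kron_transpose_mulVec_eq_zero _ z.ofLp i j hz

lemma hardA_transpose_eq_zero (L : ℝ) (z : EuclideanSpace ℝ (ConIdx m₁ m₂ d))
    (i : Fin (numBlocks m₁ m₂)) (j : Fin d)
    (hz : ∀ r : {r // r ∉ rowsM m₁ m₂}, i.val = r.1.val ∨ i.val = r.1.val + 1 → z (r, j) = 0) :
    (hardA m₁ m₂ d L)ᵀ.toEuclideanLin z (i, j) = 0 :=
  kron_transpose_mulVec_eq_zero _ z.ofLp i j hz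

lemma coord_smul_block (c : ℝ) (x : EuclideanSpace ℝ (VarIdx m₁ m₂ d))
    (i : Fin (numBlocks m₁ m₂)) {k : ℕ} (hk : k < d) :
    coord (c • block x i) (k + 1) = c * x (i, ⟨k, hk⟩) := by
  rw [coord_succ_of_lt _ hk]
  rfl

/-- The coupling to the successor vanishes because the coordinate itself is zero; the coupling to
the predecessor vanishes because either its weight or the predecessor is zero. -/
lemma hardGrad_eq_zero (ε L : ℝ) (x : EuclideanSpace ℝ (VarIdx m₁ m₂ d))
    (i : Fin (numBlocks m₁ m₂)) (k : Fin d) (hk : k.val ≠ 0) (hx : x (i, k) = 0)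
    (hx' : weight (m₁ * m₂) i k ≠ 0 → x (i, ⟨k.val - 1, by omega⟩) = 0) :
    hardGrad m₁ m₂ ε L x (i, k) = 0 := by
  have e : hardGrad m₁ m₂ ε L x (i, k) = gradScale m₁ m₂ ε *
    chainPartial (weight (m₁ * m₂) i) (argScale m₁ m₂ ε L • block x i) k := rfl
  rw [e]
  unfold chainPartial
  rw [if_neg hk, coord_smul_block _ _ _ k.2, Fin.eta, hx, mul_zero, pairFst_zero, mul_zero]
  have h1 : weight (m₁ * m₂) i k *
      pairSnd (coord (argScale m₁ m₂ ε L • block x i) k) 0 = 0 := by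
    by_cases hw : weight (m₁ * m₂) i k = 0
    · rw [hw, zero_mul]
    · obtain ⟨l, hl⟩ : ∃ l, k.val = l + 1 := ⟨k.val - 1, by omega⟩
      have hl' : l < d := by have := k.2; omega
      have h2 := hx' hw
      simp only [hl, Nat.add_sub_cancel] at h2
      rw [hl, coord_smul_block _ _ _ hl', h2, mul_zero, pairSnd_zero, mul_zero]
  rw [h1]
  simp

/-- The proximal map of a multiple of the `ℓ¹`-norm keeps zero coordinates. -/
lemma isProx_l1_eq_zero {κ : Type*} [Fintype κ] {c η : ℝ} (hc : 0 ≤ c) (hη : 0 < η)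
    {v p : EuclideanSpace ℝ κ}
    (hp : IsProx (fun y : EuclideanSpace ℝ κ => ((c * ∑ k, |y k| : ℝ) : EReal)) η v p) {k : κ}
    (hv : v k = 0) : p k = 0 := by
  classical
  -- The competitor is `p` with entry `k` set to zero. It removes both the penalty and the quadratic
  -- cost of that entry, so minimality forces the entry to vanish.
  set w : EuclideanSpace ℝ κ := WithLp.toLp 2 (Function.update p.ofLp k 0) with hw
  have hwk : w k = 0 := by simp [hw]
  have hwl : ∀ l ∈ Finset.univ.erase k, w l = p l := by
    intro l hl
    simp [hw, Function.update_of_ne (Finset.ne_of_mem_erase hl)]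
  have h1 := hp w
  simp only [← EReal.coe_add, EReal.coe_le_coe_iff] at h1
  rw [EuclideanSpace.real_norm_sq_eq, EuclideanSpace.real_norm_sq_eq,
    ← Finset.add_sum_erase _ _ (Finset.mem_univ k),
    ← Finset.add_sum_erase _ (fun l => |w l|) (Finset.mem_univ k),
    ← Finset.add_sum_erase _ (fun i => (p - v) i ^ 2) (Finset.mem_univ k),
    ← Finset.add_sum_erase _ (fun i => (w - v) i ^ 2) (Finset.mem_univ k)] at h1
  have e1 : ∑ l ∈ Finset.univ.erase k, |w l| = ∑ l ∈ Finset.univ.erase k, |p l| :=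
    Finset.sum_congr rfl fun l hl => by rw [hwl l hl]
  have e2 : ∑ l ∈ Finset.univ.erase k, (w - v) l ^ 2
      = ∑ l ∈ Finset.univ.erase k, (p - v) l ^ 2 :=
    Finset.sum_congr rfl fun l hl => by simp [hwl l hl]
  rw [e1, e2] at h1
  simp only [PiLp.sub_apply, hwk, hv, sub_zero, abs_zero, add_div] at h1
  have h2 : 0 ≤ c * |p k| := by positivity
  have h3 : p k ^ 2 / (2 * η) ≤ 0 := by
    have : (0 : ℝ) ^ 2 / (2 * η) = 0 := by simp
    linarith
  have h4 : 0 < 2 * η := by positivity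
  have h5 : p k ^ 2 ≤ 0 := by
    by_contra h
    exact absurd h3 (not_le.2 (div_pos (not_le.1 h) h4))
  exact pow_eq_zero_iff (two_ne_zero) |>.1 (le_antisymm h5 (sq_nonneg _))

lemma eq_zero_of_mem_span {κ : Type*} [Fintype κ] {S : Set (EuclideanSpace ℝ κ)} {k : κ}
    (hS : ∀ v ∈ S, v k = 0) {v : EuclideanSpace ℝ κ} (hv : v ∈ Submodule.span ℝ S) : v k = 0 := by
  induction hv using Submodule.span_induction with
  | mem v hv => exact hS v hv
  | zero => rfl
  | add v w _ _ hv hw => simp [hv, hw]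
  | smul c v _ hv => simp [hv]

/-- Strong induction on `t`: every available operation moves the support by at most one block, or by
one coordinate where the weight permits. An entry of `y` belongs to a row joining two blocks and
stays zero until one of them can be reached. -/
lemma iterates_support {ε L β : ℝ} (hε : 0 < ε) (hL : 0 < L) (hβ : 0 ≤ β)
    (hm : (0 : ℝ) < (numBlocks m₁ m₂ : ℝ)) (hd : Odd d)
    {x : ℕ → EuclideanSpace ℝ (VarIdx m₁ m₂ d)} {y : ℕ → EuclideanSpace ℝ (RegIdx m₁ m₂ d)}
    (hx0 : x 0 = 0) (hy0 : y 0 = 0) (hrun : (hardInstance m₁ m₂ d ε L β).IsFOMRun x y) (t : ℕ) :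
    (∀ i k, t < arrival (m₁ * m₂) (i : Fin _).val (k : Fin _).val → x t (i, k) = 0) ∧
    (∀ r k, t < arrival (m₁ * m₂) (r : {r // r ∈ rowsM m₁ m₂}).1.val (k : Fin d).val →
      t < arrival (m₁ * m₂) (r.1.val + 1) k.val → y t (r, k) = 0) := by
  induction t using Nat.strong_induction_on with
  | _ t ih =>
  rcases Nat.eq_zero_or_pos t with ht | ht
  · subst ht
    rw [hx0, hy0]
    exact ⟨fun _ _ _ => rfl, fun _ _ _ _ => rfl⟩
  have hfwd : ∀ s < t, ∀ (r : Fin (numBlocks m₁ m₂ - 1)) (k : Fin d),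
      t ≤ arrival (m₁ * m₂) r.val k.val → t ≤ arrival (m₁ * m₂) (r.val + 1) k.val →
      x s (⟨r.val + 1, row_succ_lt r⟩, k) - x s (⟨r.val, row_lt r⟩, k) = 0 := by
    intro s hs r k h1 h2
    rw [(ih s hs).1 _ _ (lt_of_lt_of_le hs h2), (ih s hs).1 _ _ (lt_of_lt_of_le hs h1), sub_zero]
  constructor
  · intro i k hik
    -- Before the arrival at block `i`, the time `t` has not passed the arrival at either neighbour,
    -- so every earlier `s < t` is strictly too early there.
    have hadj : ∀ r : Fin (numBlocks m₁ m₂ - 1), i.val = r.val ∨ i.val = r.val + 1 →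
        t ≤ arrival (m₁ * m₂) r.val k.val ∧ t ≤ arrival (m₁ * m₂) (r.val + 1) k.val := by
      intro r hr
      have h1 := arrival_succ_le (m₁ * m₂) r.val k.val
      have h2 := arrival_le_succ (m₁ * m₂) r.val k.val
      rcases hr with hr | hr
      · rw [hr] at hik; constructor <;> omega
      · rw [hr] at hik; constructor <;> omega
    refine eq_zero_of_mem_span ?_ (hrun.x_mem t ht)
    intro v hv
    simp only [Problem.xInfo, Set.mem_iUnion, Set.mem_Iio, exists_prop] at hv
    obtain ⟨s, hs, hv⟩ := hv
    have hxs : x s (i, k) = 0 := (ih s hs).1 i k (hs.trans hik)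
    rcases hv with rfl | rfl | rfl | rfl | rfl | rfl | rfl
    · exact hxs
    · rw [gradient_f₀ hε hL hm hd]
      have hk : k.val ≠ 0 := by
        intro hk
        simp [arrival, hk] at hik
      refine hardGrad_eq_zero ε L (x s) i k hk hxs fun hw => ?_
      refine (ih s hs).1 _ _ ?_
      have := arrival_le_of_weight hk hw
      show s < arrival (m₁ * m₂) i.val (k.val - 1)
      omega
    · exact hardA_transpose_eq_zero L 0 i k fun _ _ => rfl
    · refine hardA_transpose_eq_zero L _ i k fun r hr => ?_
      refine (hardA_apply L (x s) r k).trans ?_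
      rw [hfwd s hs r.1 k (hadj r.1 hr).1 (hadj r.1 hr).2, mul_zero]
    · exact hardAbar_transpose_eq_zero L 0 i k fun _ _ => rfl
    · refine hardAbar_transpose_eq_zero L _ i k fun r hr => ?_
      refine (hardAbar_apply L (x s) r k).trans ?_
      rw [hfwd s hs r.1 k (hadj r.1 hr).1 (hadj r.1 hr).2, mul_zero]
    · refine hardAbar_transpose_eq_zero L _ i k fun r hr => ?_
      exact (ih s hs).2 r k (lt_of_lt_of_le hs (hadj r.1 hr).1) (lt_of_lt_of_le hs (hadj r.1 hr).2)
  · intro r k h1 h2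
    obtain ⟨η, hη, ξ, hξ, p, hp, hy⟩ := hrun.y_mem t ht
    have hξ0 : ξ (r, k) = 0 := by
      refine eq_zero_of_mem_span ?_ hξ
      intro v hv
      simp only [Problem.yInfo, Set.mem_iUnion, Set.mem_Iio, exists_prop] at hv
      obtain ⟨s, hs, hv⟩ := hv
      rcases hv with rfl | rfl | rfl | rfl
      · rfl
      · exact (ih s hs).2 r k (hs.trans h1) (hs.trans h2)
      · refine (hardAbar_apply L _ r k).trans ?_
        have hz : ∀ i : Fin (numBlocks m₁ m₂), i.val = r.1.val ∨ i.val = r.1.val + 1 →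
            (hardAbar m₁ m₂ d L)ᵀ.toEuclideanLin (y s) (i, k) = 0 := by
          intro i hi
          refine hardAbar_transpose_eq_zero L _ i k fun r' hr' => ?_
          -- `Ā Āᵀ` couples only rows that share a block, that is, rows whose indices differ by at
          -- most one.
          have hcase : r'.1.val = r.1.val ∨ r'.1.val = r.1.val + 1 ∨ r'.1.val + 1 = r.1.val := by
            omega
          have a1 := arrival_le_succ (m₁ * m₂) r.1.val k.val
          have a2 := arrival_le_succ (m₁ * m₂) (r.1.val + 1) k.val
          have a3 := arrival_succ_le (m₁ * m₂) r'.1.val k.val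
          rcases hcase with e | e | e
          · refine (ih s hs).2 r' k ?_ ?_ <;> rw [e] <;> omega
          · refine (ih s hs).2 r' k ?_ ?_ <;> rw [e] <;> omega
          · rw [e] at a3
            refine (ih s hs).2 r' k ?_ ?_
            · omega
            · rw [e]; omega
        have z₁ := hz ⟨r.1.val, row_lt r.1⟩ (Or.inl rfl)
        have z₂ := hz ⟨r.1.val + 1, row_succ_lt r.1⟩ (Or.inr rfl)
        exact (congrArg _ ((congrArg₂ (· - ·) z₂ z₁).trans (sub_zero 0))).trans (mul_zero _)
      · refine (hardAbar_apply L (x s) r k).trans ?_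
        rw [hfwd s hs r.1 k h1.le h2.le, mul_zero]
    have hc : 0 ≤ β / ((numBlocks m₁ m₂ : ℝ) * L) := by positivity
    have hp0 : p (r, k) = 0 := isProx_l1_eq_zero hc hη hp hξ0
    refine eq_zero_of_mem_span ?_ hy
    rintro v (rfl | rfl)
    · exact hξ0
    · exact hp0

end support

/-! ### Stationary points -/

/-- If `ξ` is a subgradient of a multiple of the `ℓ¹`-norm at `y`, then its entries on the support
of `y` have full size. -/
lemma le_abs_of_mem_subdifferential_l1 {κ : Type*} [Fintype κ] {c : ℝ} {y ξ : EuclideanSpace ℝ κ}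
    (hξ : ξ ∈ subdifferential (fun y : EuclideanSpace ℝ κ => ((c * ∑ k, |y k| : ℝ) : EReal)) y)
    {k : κ} (hy : y k ≠ 0) : c ≤ |ξ k| := by
  classical
  -- The subgradient inequality is tested at `y` with entry `k` removed, which isolates that entry.
  have h1 := hξ (y - EuclideanSpace.single k (y k))
  rw [← EReal.coe_add, EReal.coe_le_coe_iff, sub_sub_cancel_left, inner_neg_right,
    EuclideanSpace.inner_single_right, ← Finset.add_sum_erase _ _ (Finset.mem_univ k),
    ← Finset.add_sum_erase _ (fun l => |(y - EuclideanSpace.single k (y k)) l|)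
      (Finset.mem_univ k)] at h1
  have e1 : ∑ l ∈ Finset.univ.erase k, |(y - EuclideanSpace.single k (y k)) l|
      = ∑ l ∈ Finset.univ.erase k, |y l| :=
    Finset.sum_congr rfl fun l hl => by simp [Finset.ne_of_mem_erase hl]
  rw [e1] at h1
  simp only [PiLp.sub_apply, PiLp.single_apply, if_true, sub_self, abs_zero, conj_trivial] at h1
  have h2 : c * |y k| ≤ |ξ k| * |y k| := by
    rw [← abs_mul]
    have := le_abs_self (ξ k * y k)
    linarith
  exact le_of_mul_le_mul_right h2 (abs_pos.2 hy)

/-- The sequence of the entries number `j` of the blocks of `v` (zero beyond the last block). -/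
def blockSeq {m d : ℕ} (v : EuclideanSpace ℝ (Fin m × Fin d)) (j : Fin d) (i : ℕ) : ℝ :=
  if hi : i < m then v (⟨i, hi⟩, j) else 0

lemma blockSeq_fin {m d : ℕ} (v : EuclideanSpace ℝ (Fin m × Fin d)) (j : Fin d) (i : Fin m) :
    blockSeq v j i = v (i, j) := by
  simp [blockSeq]

lemma sum_blockSeq_sq_le {m d : ℕ} (v : EuclideanSpace ℝ (Fin m × Fin d)) (j : Fin d) :
    ∑ i ∈ Finset.range m, blockSeq v j i ^ 2 ≤ ‖v‖ ^ 2 := by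
  rw [EuclideanSpace.real_norm_sq_eq, Fintype.sum_prod_type_right, Finset.sum_range]
  simp only [blockSeq_fin]
  exact Finset.single_le_sum (f := fun j => ∑ i, v (i, j) ^ 2)
    (fun j _ => Finset.sum_nonneg fun i _ => sq_nonneg _) (Finset.mem_univ j)

lemma abs_sum_blockSeq_le {m d : ℕ} (v : EuclideanSpace ℝ (Fin m × Fin d)) (j : Fin d) {k : ℕ}
    (hk : k ≤ m) : |∑ i ∈ Finset.range k, blockSeq v j i| ≤ √m * ‖v‖ := by
  refine abs_le_of_sq_le_sq ?_ (by positivity)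
  rw [mul_pow, Real.sq_sqrt (Nat.cast_nonneg _)]
  exact (sq_sum_range_le hk).trans
    (mul_le_mul_of_nonneg_left (sum_blockSeq_sq_le v j) (Nat.cast_nonneg _))

lemma sq_sub_zero_le (X : ℕ → ℝ) {i n : ℕ} (hi : i ≤ n) :
    (X i - X 0) ^ 2 ≤ i * ∑ r ∈ Finset.range n, (X (r + 1) - X r) ^ 2 := by
  rw [← Finset.sum_range_sub]
  refine (sq_sum_range_le le_rfl).trans ?_
  refine mul_le_mul_of_nonneg_left ?_ (Nat.cast_nonneg _)
  exact Finset.sum_le_sum_of_subset_of_nonneg (Finset.range_subset_range.2 hi)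
    fun _ _ _ => sq_nonneg _

section hard

variable {m₁ m₂ d : ℕ} {ε L β : ℝ}

lemma blockSeq_residual (x : EuclideanSpace ℝ (VarIdx m₁ m₂ d))
    (z₁ : EuclideanSpace ℝ (RegIdx m₁ m₂ d)) (z₂ : EuclideanSpace ℝ (ConIdx m₁ m₂ d))
    (j : Fin d) {i : ℕ} (hi : i < numBlocks m₁ m₂) :
    blockSeq (hardGrad m₁ m₂ ε L x + (hardAbar m₁ m₂ d L)ᵀ.toEuclideanLin z₁
      + (hardA m₁ m₂ d L)ᵀ.toEuclideanLin z₂) j i =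
    blockSeq (hardGrad m₁ m₂ ε L x) j i
      + (numBlocks m₁ m₂ : ℝ) * L * backDiff (mergeRows z₁.ofLp z₂.ofLp j) i := by
  have h1 := transpose_mulVec_add L z₁.ofLp z₂.ofLp ⟨i, hi⟩ j
  simp only [blockSeq, hi, dif_pos]
  rw [← h1, ← add_assoc]
  rfl

/-- Summing over the blocks up to `n` cancels every multiplier except the one of row `n`, the only
row joining these blocks to the rest. -/
lemma sum_blockSeq_residual (x : EuclideanSpace ℝ (VarIdx m₁ m₂ d))
    (z₁ : EuclideanSpace ℝ (RegIdx m₁ m₂ d)) (z₂ : EuclideanSpace ℝ (ConIdx m₁ m₂ d))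
    (j : Fin d) {n : ℕ} (hn : n < numBlocks m₁ m₂) :
    ∑ i ∈ Finset.range (n + 1), blockSeq (hardGrad m₁ m₂ ε L x
      + (hardAbar m₁ m₂ d L)ᵀ.toEuclideanLin z₁ + (hardA m₁ m₂ d L)ᵀ.toEuclideanLin z₂) j i =
    ∑ i ∈ Finset.range (n + 1), blockSeq (hardGrad m₁ m₂ ε L x) j i
      - (numBlocks m₁ m₂ : ℝ) * L * mergeRows z₁.ofLp z₂.ofLp j n := by
  rw [Finset.sum_congr rfl fun i hi => blockSeq_residual x z₁ z₂ j
    (by have := Finset.mem_range.1 hi; omega), Finset.sum_add_distrib, ← Finset.mul_sum,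
    sum_range_backDiff]
  ring

lemma numBlocks_mul_gradScale (hm : (0 : ℝ) < (numBlocks m₁ m₂ : ℝ)) :
    (numBlocks m₁ m₂ : ℝ) * gradScale m₁ m₂ ε = 2 * √(numBlocks m₁ m₂ : ℝ) * ε := by
  unfold gradScale
  have hs : 0 < √(numBlocks m₁ m₂ : ℝ) := Real.sqrt_pos.2 hm
  have hsq : √(numBlocks m₁ m₂ : ℝ) ^ 2 = (numBlocks m₁ m₂ : ℝ) := Real.sq_sqrt hm.le
  generalize √(numBlocks m₁ m₂ : ℝ) = s at *
  rw [← hsq]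
  field_simp

/-- At most `m` terms, each bounded by `gradScale · 25π`, and `m · gradScale = 2 √m ε`. -/
lemma abs_sum_blockSeq_hardGrad_le (hε : 0 < ε) (hm : (0 : ℝ) < (numBlocks m₁ m₂ : ℝ))
    (x : EuclideanSpace ℝ (VarIdx m₁ m₂ d)) (j : Fin d) {k : ℕ} (hk : k ≤ numBlocks m₁ m₂) :
    |∑ i ∈ Finset.range k, blockSeq (hardGrad m₁ m₂ ε L x) j i| ≤
      50 * Real.pi * √(numBlocks m₁ m₂ : ℝ) * ε := by
  have hg := gradScale_pos (m₁ := m₁) (m₂ := m₂) hε hm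
  refine (Finset.abs_sum_le_sum_abs _ _).trans ?_
  have h1 : ∀ i ∈ Finset.range k, |blockSeq (hardGrad m₁ m₂ ε L x) j i| ≤
      gradScale m₁ m₂ ε * (25 * Real.pi) := by
    intro i hi
    have hi' : i < numBlocks m₁ m₂ := by have := Finset.mem_range.1 hi; omega
    simp only [blockSeq, hi', dif_pos, hardGrad, abs_mul, abs_of_pos hg]
    exact mul_le_mul_of_nonneg_left
      (abs_chainPartial_le (weight_nonneg _ _) (weight_le _ _) _ _) hg.le
  refine (Finset.sum_le_sum h1).trans ?_
  rw [Finset.sum_const, Finset.card_range, nsmul_eq_mul]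
  have hpi := Real.pi_pos
  calc (k : ℝ) * (gradScale m₁ m₂ ε * (25 * Real.pi))
      ≤ (numBlocks m₁ m₂ : ℝ) * (gradScale m₁ m₂ ε * (25 * Real.pi)) :=
        mul_le_mul_of_nonneg_right (by exact_mod_cast hk) (by positivity)
    _ = (numBlocks m₁ m₂ : ℝ) * gradScale m₁ m₂ ε * (25 * Real.pi) := by ring
    _ = _ := by rw [numBlocks_mul_gradScale hm]; ring

/-- At a stationary point the split variable vanishes. -/
lemma stationary_split_eq_zero (hε : 0 < ε) (hL : 0 < L) (hm₁ : 2 ≤ m₁) (hm₂ : 1 ≤ m₂)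
    (hd : 0 < d)
    (hβ : (50 * Real.pi + 1 + specNorm (hardA m₁ m₂ d L)) * √(numBlocks m₁ m₂ : ℝ) * ε < β)
    {x : EuclideanSpace ℝ (VarIdx m₁ m₂ d)} {y : EuclideanSpace ℝ (RegIdx m₁ m₂ d)}
    {z₁ : EuclideanSpace ℝ (RegIdx m₁ m₂ d)} {z₂ : EuclideanSpace ℝ (ConIdx m₁ m₂ d)}
    (hsub : Metric.infEDist 0 ((fun ξ => ξ - z₁) ''
      subdifferential (hardInstance m₁ m₂ d ε L β).gbar y) ≤ ENNReal.ofReal ε)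
    (hgrad : ‖hardGrad m₁ m₂ ε L x + (hardAbar m₁ m₂ d L)ᵀ.toEuclideanLin z₁
      + (hardA m₁ m₂ d L)ᵀ.toEuclideanLin z₂‖ ≤ ε) : y = 0 := by
  have hm := numBlocks_pos hm₁ hm₂
  have hmL : 0 < (numBlocks m₁ m₂ : ℝ) * L := mul_pos hm hL
  have hs1 : 1 ≤ √(numBlocks m₁ m₂ : ℝ) := by
    rw [Real.one_le_sqrt]
    have : 0 < numBlocks m₁ m₂ := by exact_mod_cast hm
    exact_mod_cast this
  set s := √(numBlocks m₁ m₂ : ℝ) with hs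
  ext ⟨r, j⟩
  by_contra hy
  -- The distance is an infimum that need not be attained, so a subgradient is taken within `ε + δ`.
  -- Here `m L δ` is exactly the slack in the strict bound on `β`.
  set δ := (β - (50 * Real.pi + 1 + specNorm (hardA m₁ m₂ d L)) * s * ε) /
    ((numBlocks m₁ m₂ : ℝ) * L) with hδ
  have hδ0 : 0 < δ := div_pos (sub_pos.2 hβ) hmL
  have hlt : Metric.infEDist 0 ((fun ξ => ξ - z₁) ''
      subdifferential (hardInstance m₁ m₂ d ε L β).gbar y) < ENNReal.ofReal (ε + δ) :=
    hsub.trans_lt ((ENNReal.ofReal_lt_ofReal_iff (by linarith)).2 (by linarith))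
  obtain ⟨_, ⟨ξ, hξ, rfl⟩, hξd⟩ := Metric.infEDist_lt_iff.1 hlt
  rw [edist_dist, ENNReal.ofReal_lt_ofReal_iff (by linarith), dist_zero_left] at hξd
  have h1 : β / ((numBlocks m₁ m₂ : ℝ) * L) ≤ |ξ (r, j)| :=
    le_abs_of_mem_subdifferential_l1 hξ hy
  have h2 : |ξ (r, j)| < |z₁ (r, j)| + (ε + δ) := by
    have a1 : |ξ (r, j) - z₁ (r, j)| ≤ ‖ξ - z₁‖ := PiLp.norm_apply_le (ξ - z₁) (r, j)
    have a2 := abs_sub_abs_le_abs_sub (ξ (r, j)) (z₁ (r, j))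
    linarith
  -- The multiplier is the difference of two partial sums: the gradient contributes `50π √m ε` and
  -- the stationarity residual `√m ε`.
  have h3 : (numBlocks m₁ m₂ : ℝ) * L * |z₁ (r, j)| ≤ (50 * Real.pi + 1) * s * ε := by
    have hr := row_lt r.1
    have a1 := sum_blockSeq_residual (ε := ε) (L := L) x z₁ z₂ j hr
    rw [mergeRows_reg] at a1
    have a2 := abs_sum_blockSeq_le (hardGrad m₁ m₂ ε L x + (hardAbar m₁ m₂ d L)ᵀ.toEuclideanLin z₁
      + (hardA m₁ m₂ d L)ᵀ.toEuclideanLin z₂) j (k := r.1.val + 1) hr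
    have a3 := abs_sum_blockSeq_hardGrad_le (L := L) hε hm x j (k := r.1.val + 1) hr
    have a4 : s * ‖hardGrad m₁ m₂ ε L x + (hardAbar m₁ m₂ d L)ᵀ.toEuclideanLin z₁
      + (hardA m₁ m₂ d L)ᵀ.toEuclideanLin z₂‖ ≤ s * ε :=
      mul_le_mul_of_nonneg_left hgrad (by linarith)
    have a5 := a2.trans a4
    rw [a1] at a5
    rw [← hs] at a3
    rw [← abs_of_pos hmL, ← abs_mul]
    rw [abs_le] at *
    constructor <;> linarith [a5.1, a5.2, a3.1, a3.2]
  have h4 : β < (numBlocks m₁ m₂ : ℝ) * L * (|z₁ (r, j)| + (ε + δ)) := by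
    have := h1.trans_lt h2
    rwa [div_lt_iff₀' hmL] at this
  have h5 : (numBlocks m₁ m₂ : ℝ) * L * δ =
      β - (50 * Real.pi + 1 + specNorm (hardA m₁ m₂ d L)) * s * ε := by
    rw [hδ]
    field_simp
  have hnorm := le_specNorm_hardA (d := d) hL hm₁ hm₂ hd
  have h6 : (numBlocks m₁ m₂ : ℝ) * L * ε ≤ specNorm (hardA m₁ m₂ d L) * s * ε := by
    refine mul_le_mul_of_nonneg_right (hnorm.trans ?_) hε.le
    exact le_mul_of_one_le_right (norm_nonneg _) hs1
  linarith

/-- At a stationary point with vanishing split variable the blocks almost agree. -/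
lemma sum_norm_block_sub_le (hL : 0 < L) (hm : 0 < numBlocks m₁ m₂) (hε : 0 < ε)
    {x : EuclideanSpace ℝ (VarIdx m₁ m₂ d)}
    (h₁ : ‖(hardAbar m₁ m₂ d L).toEuclideanLin x‖ ≤ ε) (h₂ : ‖(hardA m₁ m₂ d L).toEuclideanLin x‖ ≤ ε) :
    L * ∑ i, ‖block x i - block x ⟨0, hm⟩‖ ≤ √(numBlocks m₁ m₂ : ℝ) * ε := by
  have hmR : (0 : ℝ) < (numBlocks m₁ m₂ : ℝ) := by exact_mod_cast hm
  set m := numBlocks m₁ m₂ with hmdef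
  have hS : ((m : ℝ) * L) ^ 2 * ∑ j, ∑ r ∈ Finset.range (m - 1),
      (blockSeq x j (r + 1) - blockSeq x j r) ^ 2 ≤ 2 * ε ^ 2 := by
    have e1 := sum_mergeRows_sq ((hardAbar m₁ m₂ d L).toEuclideanLin x).ofLp
      ((hardA m₁ m₂ d L).toEuclideanLin x).ofLp
    rw [← EuclideanSpace.real_norm_sq_eq, ← EuclideanSpace.real_norm_sq_eq] at e1
    have e2 : ∀ j, ∀ r ∈ Finset.range (m - 1),
        mergeRows ((hardAbar m₁ m₂ d L).toEuclideanLin x).ofLp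
          ((hardA m₁ m₂ d L).toEuclideanLin x).ofLp j r ^ 2 =
        ((m : ℝ) * L) ^ 2 * (blockSeq x j (r + 1) - blockSeq x j r) ^ 2 := by
      intro j r hr
      have hr := Finset.mem_range.1 hr
      have hr1 : r < m := by omega
      have hr2 : r + 1 < m := by omega
      rw [← mul_pow]
      congr 1
      simp only [mergeRows, blockSeq, ← hmdef, hr, hr1, hr2, dif_pos]
      split_ifs with hM
      · exact hardAbar_apply L x ⟨_, hM⟩ j
      · exact hardA_apply L x ⟨_, hM⟩ j
    rw [Finset.mul_sum]
    simp only [Finset.mul_sum]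
    rw [Finset.sum_congr rfl fun j _ => Finset.sum_congr rfl (e2 j)] at e1
    rw [e1]
    have a1 := pow_le_pow_left₀ (norm_nonneg _) h₁ 2
    have a2 := pow_le_pow_left₀ (norm_nonneg _) h₂ 2
    linarith
  set S := ∑ j, ∑ r ∈ Finset.range (m - 1), (blockSeq x j (r + 1) - blockSeq x j r) ^ 2
  have hb : ∀ i : Fin m, ‖block x i - block x ⟨0, hm⟩‖ ^ 2 ≤ (i.val : ℝ) * S := by
    intro i
    rw [EuclideanSpace.real_norm_sq_eq, Finset.mul_sum]
    refine Finset.sum_le_sum fun j _ => ?_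
    have h3 := sq_sub_zero_le (blockSeq x j) (i := i.val) (n := m - 1) (by have := i.2; omega)
    rw [blockSeq_fin] at h3
    have h4 : blockSeq x j 0 = x (⟨0, hm⟩, j) := blockSeq_fin x j ⟨0, hm⟩
    rw [h4] at h3
    exact h3
  -- The factor `1/2` cancels the `2` in `hS`, which comes from adding the two residuals, so the
  -- final constant is 1.
  have hsum : (∑ i : Fin m, (i.val : ℝ)) ≤ (m : ℝ) ^ 2 / 2 := by
    rw [← Finset.sum_range (fun i => (i : ℝ)), ← Nat.cast_sum]
    have h3 := Finset.sum_range_id_mul_two m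
    have h4 : (∑ i ∈ Finset.range m, i) * 2 ≤ m * m := by
      rw [h3]; exact Nat.mul_le_mul_left _ (Nat.sub_le _ _)
    have h5 : ((∑ i ∈ Finset.range m, i : ℕ) : ℝ) * 2 ≤ (m : ℝ) * m := by exact_mod_cast h4
    linarith
  have hS0 : 0 ≤ S := Finset.sum_nonneg fun _ _ => Finset.sum_nonneg fun _ _ => sq_nonneg _
  refine abs_le_of_sq_le_sq' ?_ (by positivity) |>.2
  rw [mul_pow, mul_pow, Real.sq_sqrt hmR.le]
  have h6 : (∑ i, ‖block x i - block x ⟨0, hm⟩‖) ^ 2 ≤ (m : ℝ) * ((m : ℝ) ^ 2 / 2 * S) := by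
    refine (sq_sum_le_card_mul_sum_sq (s := Finset.univ)).trans ?_
    rw [Finset.card_univ, Fintype.card_fin]
    refine mul_le_mul_of_nonneg_left ?_ hmR.le
    refine (Finset.sum_le_sum fun i _ => hb i).trans ?_
    rw [← Finset.sum_mul]
    exact mul_le_mul_of_nonneg_right hsum hS0
  calc L ^ 2 * _ ≤ L ^ 2 * ((m : ℝ) * ((m : ℝ) ^ 2 / 2 * S)) :=
        mul_le_mul_of_nonneg_left h6 (by positivity)
    _ = (m : ℝ) / 2 * (((m : ℝ) * L) ^ 2 * S) := by ring
    _ ≤ (m : ℝ) / 2 * (2 * ε ^ 2) := mul_le_mul_of_nonneg_left hS (by positivity)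
    _ = _ := by ring

/-- The partial derivatives are affine in the weights, and the weights average to one: at a common
point the split chains add up to `m` copies of the full chain. -/
lemma sum_chainPartial_weight (z : EuclideanSpace ℝ (Fin d)) (k : ℕ) :
    ∑ i : Fin (numBlocks m₁ m₂), chainPartial (weight (m₁ * m₂) i) z k
      = (numBlocks m₁ m₂ : ℝ) * chainPartial (fun _ => 1) z k := by
  have e2 : ∀ k, ∑ i : Fin (numBlocks m₁ m₂), weight (m₁ * m₂) i k = (numBlocks m₁ m₂ : ℝ) := by
    intro k
    have e : (numBlocks m₁ m₂ : ℕ) = 3 * (m₁ * m₂) := by unfold numBlocks; ring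
    rw [e]
    simpa using sum_weight (m₁ * m₂) k
  simp only [chainPartial, Finset.sum_add_distrib, mul_add]
  congr 1
  · split_ifs
    · simp
    · rw [← Finset.sum_mul, e2, one_mul]
  · split_ifs
    · rw [← Finset.sum_mul, e2, one_mul]
    · simp

/-- A point whose last coordinates all vanish is not stationary. -/
theorem not_isStationarySP (hε : 0 < ε) (hL : 0 < L) (hm₁ : 2 ≤ m₁) (hm₂ : 1 ≤ m₂) (hd : Odd d)
    (hβ : (50 * Real.pi + 1 + specNorm (hardA m₁ m₂ d L)) * √(numBlocks m₁ m₂ : ℝ) * ε < β)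
    {x : EuclideanSpace ℝ (VarIdx m₁ m₂ d)} {y : EuclideanSpace ℝ (RegIdx m₁ m₂ d)}
    (hx : ∀ i k, (k : Fin d).val + 1 = d → x (i, k) = 0) :
    ¬ (hardInstance m₁ m₂ d ε L β).IsStationarySP ε x y := by
  rintro ⟨z₁, z₂, hsub, hgrad, hyx, hAx⟩
  have hmR := numBlocks_pos hm₁ hm₂
  have hm : 0 < numBlocks m₁ m₂ := by exact_mod_cast hmR
  rw [gradient_f₀ hε hL hmR hd] at hgrad
  have hgrad' : ‖hardGrad m₁ m₂ ε L x + (hardAbar m₁ m₂ d L)ᵀ.toEuclideanLin z₁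
      + (hardA m₁ m₂ d L)ᵀ.toEuclideanLin z₂‖ ≤ ε := hgrad
  have hy := stationary_split_eq_zero hε hL hm₁ hm₂ hd.pos hβ hsub hgrad'
  have h₁ : ‖(hardAbar m₁ m₂ d L).toEuclideanLin x‖ ≤ ε := by
    have e : y - (hardInstance m₁ m₂ d ε L β).Abar.toEuclideanLin x
        - (hardInstance m₁ m₂ d ε L β).bbar = -(hardAbar m₁ m₂ d L).toEuclideanLin x := by
      rw [hy, zero_sub]
      exact sub_zero _
    rwa [e, norm_neg] at hyx
  have h₂ : ‖(hardA m₁ m₂ d L).toEuclideanLin x‖ ≤ ε := by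
    have e : (hardInstance m₁ m₂ d ε L β).A.toEuclideanLin x
        + (hardInstance m₁ m₂ d ε L β).b = (hardA m₁ m₂ d L).toEuclideanLin x := add_zero _
    rwa [e] at hAx
  have hcons := sum_norm_block_sub_le hL hm hε h₁ h₂
  set z := argScale m₁ m₂ ε L • block x ⟨0, hm⟩ with hz
  have hzlast : |coord z d| < 1 := by
    obtain ⟨l, hl⟩ : ∃ l, d = l + 1 := ⟨d - 1, by have := hd.pos; omega⟩
    have hld : l < d := by omega
    have : coord z (l + 1) = 0 := by
      rw [hz, coord_smul_block _ _ _ hld, hx _ _ hl.symm, mul_zero]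
    rw [← hl] at this
    rw [this]
    simp
  obtain ⟨k, hk, hlt⟩ := exists_chainPartial_one_lt hd.pos z hzlast
  set j : Fin d := ⟨k, hk⟩
  have hg := gradScale_pos (m₁ := m₁) (m₂ := m₂) hε hmR
  -- Over all blocks the telescoped multiplier lies beyond the last row and is zero, so only the
  -- residual remains.
  have hsumgrad : |∑ i, hardGrad m₁ m₂ ε L x (i, j)| ≤ √(numBlocks m₁ m₂ : ℝ) * ε := by
    have hn : numBlocks m₁ m₂ - 1 < numBlocks m₁ m₂ := by omega
    have a1 := sum_blockSeq_residual (ε := ε) (L := L) x z₁ z₂ j hn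
    rw [mergeRows_of_le _ _ _ le_rfl, mul_zero, sub_zero, Nat.sub_add_cancel hm] at a1
    have a2 := abs_sum_blockSeq_le (hardGrad m₁ m₂ ε L x + (hardAbar m₁ m₂ d L)ᵀ.toEuclideanLin z₁
      + (hardA m₁ m₂ d L)ᵀ.toEuclideanLin z₂) j le_rfl
    rw [a1, Finset.sum_range] at a2
    simp only [blockSeq_fin] at a2
    exact a2.trans (mul_le_mul_of_nonneg_left hgrad' (Real.sqrt_nonneg _))
  -- Replacing each block by block 0 costs at most `L ∑ ‖x_i - x_0‖`, which `hcons` bounds. This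
  -- error and `hsumgrad` together allow `2 √m ε`, and `hbig` strictly exceeds that.
  have hdiff : |∑ i, hardGrad m₁ m₂ ε L x (i, j) - ∑ i : Fin (numBlocks m₁ m₂),
      gradScale m₁ m₂ ε * chainPartial (weight (m₁ * m₂) i) z k| ≤
      √(numBlocks m₁ m₂ : ℝ) * ε := by
    refine le_trans ?_ hcons
    rw [← Finset.sum_sub_distrib, Finset.mul_sum]
    refine (Finset.abs_sum_le_sum_abs _ _).trans (Finset.sum_le_sum fun i _ => ?_)
    refine le_trans ?_ (norm_scaled_chainGrad_sub_le hε hL hmR i _ _)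
    have e : hardGrad m₁ m₂ ε L x (i, j) - gradScale m₁ m₂ ε *
        chainPartial (weight (m₁ * m₂) i) z k = gradScale m₁ m₂ ε *
        (chainGrad (weight (m₁ * m₂) i) (argScale m₁ m₂ ε L • block x i)
          - chainGrad (weight (m₁ * m₂) i) z) j := by
      rw [PiLp.sub_apply, mul_sub]
      rfl
    rw [e, abs_mul, abs_of_pos hg]
    have h3 := PiLp.norm_apply_le (chainGrad (weight (m₁ * m₂) i) (argScale m₁ m₂ ε L • block x i)
      - chainGrad (weight (m₁ * m₂) i) z) j
    exact mul_le_mul_of_nonneg_left h3 hg.le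
  have hbig : ∑ i : Fin (numBlocks m₁ m₂),
      gradScale m₁ m₂ ε * chainPartial (weight (m₁ * m₂) i) z k <
      -(2 * √(numBlocks m₁ m₂ : ℝ) * ε) := by
    rw [← Finset.mul_sum, sum_chainPartial_weight, ← numBlocks_mul_gradScale hmR]
    have := mul_lt_mul_of_pos_left hlt (mul_pos hmR hg)
    linarith
  rw [abs_le] at hsumgrad hdiff
  linarith [hsumgrad.1, hdiff.2]

end hard

end AffineComposite

end

/-! ### The oracle-call bound -/

theorem theorem2 (ε L : ℝ) (hε : 0 < ε) (hL : 0 < L)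
    (m₁ m₂ dbar : ℕ) (hm₁ : 2 ≤ m₁) (hm₂ : 1 ≤ m₂) (heven : Even (m₁ * m₂))
    (hdbar : 5 ≤ dbar) (hodd : Odd dbar)
    (β : ℝ)
    (hβ : (50 * Real.pi + 1 + AffineComposite.specNorm (AffineComposite.hardA m₁ m₂ dbar L)) *
      √(AffineComposite.numBlocks m₁ m₂ : ℝ) * ε < β) :
    (AffineComposite.hardInstance m₁ m₂ dbar ε L β).InClass L ∧
    ∀ (x : ℕ → EuclideanSpace ℝ (AffineComposite.VarIdx m₁ m₂ dbar))
      (y : ℕ → EuclideanSpace ℝ (AffineComposite.RegIdx m₁ m₂ dbar)),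
      x 0 = 0 → y 0 = 0 →
      (AffineComposite.hardInstance m₁ m₂ dbar ε L β).IsFOMRun x y →
      ((⌈AffineComposite.condNumber
            (Matrix.fromRows (AffineComposite.hardInstance m₁ m₂ dbar ε L β).Abar
              (AffineComposite.hardInstance m₁ m₂ dbar ε L β).A) *
          L * (AffineComposite.hardInstance m₁ m₂ dbar ε L β).gap (x 0) /
          (72000 * Real.pi ^ 2) * (ε ^ 2)⁻¹⌉₊ : ℕ) : ℕ∞) ≤
        (AffineComposite.hardInstance m₁ m₂ dbar ε L β).oracleCalls ε x y := by
  open AffineComposite in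
  have hpi := Real.pi_pos
  have hmR := numBlocks_pos hm₁ hm₂
  have hm : 0 < numBlocks m₁ m₂ := by exact_mod_cast hmR
  have hβ0 : 0 ≤ β := by
    have : 0 ≤ specNorm (hardA m₁ m₂ dbar L) := norm_nonneg _
    exact le_trans (by positivity) hβ.le
  refine ⟨hardInstance_inClass hε hL hβ0 hm₁ hm₂ hodd, fun x y hx0 hy0 hrun => ?_⟩
  refine le_iInf₂ fun t ht => ?_
  rw [Nat.cast_le, Nat.ceil_le]
  -- The last coordinate has index `d̄ - 1`, so `le_arrival` gives arrival time at least `(d̄ - 2)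
  -- N` in every block.
  have hlate : (dbar - 2) * (m₁ * m₂) ≤ t := by
    by_contra hlt
    refine not_isStationarySP hε hL hm₁ hm₂ hodd hβ (fun i k hk => ?_) ht
    refine (iterates_support hε hL hβ0 hmR hodd hx0 hy0 hrun t).1 i k ?_
    refine lt_of_lt_of_le (not_le.1 hlt) (le_trans (le_of_eq ?_) le_arrival)
    congr 1
    omega
  have hcond : condNumber (Matrix.fromRows (hardInstance m₁ m₂ dbar ε L β).Abar
      (hardInstance m₁ m₂ dbar ε L β).A) ≤ 2 * (numBlocks m₁ m₂ : ℝ) := condNumber_le hL hm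
  have hgap := gap_le (ε := ε) hL hβ0 hmR hodd
  rw [hx0]
  have hprod : condNumber (Matrix.fromRows (hardInstance m₁ m₂ dbar ε L β).Abar
      (hardInstance m₁ m₂ dbar ε L β).A) * (hardInstance m₁ m₂ dbar ε L β).gap 0 ≤
      2 * (numBlocks m₁ m₂ : ℝ) * (1200 * Real.pi ^ 2 * ε ^ 2 * dbar / L) := by
    have h0 : 0 ≤ condNumber (Matrix.fromRows (hardInstance m₁ m₂ dbar ε L β).Abar
      (hardInstance m₁ m₂ dbar ε L β).A) := Real.sqrt_nonneg _
    exact (mul_le_mul_of_nonneg_left hgap h0).trans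
      (mul_le_mul_of_nonneg_right hcond (by positivity))
  have hfac : 0 ≤ L / (72000 * Real.pi ^ 2) * (ε ^ 2)⁻¹ := by positivity
  have hN : (numBlocks m₁ m₂ : ℝ) = 3 * ((m₁ * m₂ : ℕ) : ℝ) := by
    unfold numBlocks; push_cast; ring
  calc _ = condNumber (Matrix.fromRows (hardInstance m₁ m₂ dbar ε L β).Abar
          (hardInstance m₁ m₂ dbar ε L β).A) * (hardInstance m₁ m₂ dbar ε L β).gap 0 *
          (L / (72000 * Real.pi ^ 2) * (ε ^ 2)⁻¹) := by ring
    _ ≤ 2 * (numBlocks m₁ m₂ : ℝ) * (1200 * Real.pi ^ 2 * ε ^ 2 * dbar / L) *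
          (L / (72000 * Real.pi ^ 2) * (ε ^ 2)⁻¹) := mul_le_mul_of_nonneg_right hprod hfac
    -- `2 · 1200 / 72000 = 1/30`, and `m = 3 N`.
    _ = (dbar : ℝ) / 10 * ((m₁ * m₂ : ℕ) : ℝ) := by
      rw [hN]
      field_simp
      norm_num
    _ ≤ ((dbar : ℝ) - 2) * ((m₁ * m₂ : ℕ) : ℝ) := by
      refine mul_le_mul_of_nonneg_right ?_ (Nat.cast_nonneg _)
      have : (5 : ℝ) ≤ dbar := by exact_mod_cast hdbar
      linarith
    _ = (((dbar - 2) * (m₁ * m₂) : ℕ) : ℝ) := by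
      rw [Nat.cast_mul (dbar - 2), Nat.cast_sub (by omega), Nat.cast_ofNat]
    _ ≤ t := by exact_mod_cast hlate
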